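/- Let $\gamma_1,\gamma_2,\gamma_3,\gamma_s,\rho_1,\rho_2,\rho_3$ be real antisymmetric $8\times 8$ matrices, each with square $-1$, and pairwise anticommuting. Let $M$ be a real invertible $3\times3$ matrix, let $R>0$, and let $\lambda_1,\lambda_2,\lambda_3>0$ be the positive square roots of the eigenvalues of $M^TM$ (with multiplicity). Consider the differential operator $$\mathcal D=\sum_{k=1}^3\gamma_k\frac{\partial}{\partial x_k}+\sqrt2\, iR\sum_{j,k=1}^3M_{jk}x_j\rho_k$$ on smooth compactly supported maps $\mathbb R^3\to\mathbb C^8$. Its closure in $\mathbb L=L^2(\mathbb R^3;\mathbb C^8)$ (again denoted $\mathcal D$) is an unbounded self-adjoint operator extending it. The spectrum of $\mathcal D$ has no accumulation points in $\mathbb C$ and consists of eigenvalues of finite multiplicity. Moreover: 1. The kernel of $\mathcal D$ is $1$-dimensional. 2. Let $\Delta$ be the set of data $(\epsilon_0,(\delta_1,\delta_2,\delta_3),(n_1,n_2,n_3))$ with $\epsilon_0\in\{1,-1\}$, $\delta_k\in\{0,1\}$, $n_k\in\{0,1,2,\dots\}$, not all of the $\delta_k$ and $n_k$ being zero. The nonzero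 eigenvalues of $\mathcal D$ are exactly the numbers $$\epsilon_0\Bigl(2\sqrt2\,R\sum_{k=1}^3(\delta_k+n_k)\lambda_k\Bigr)^{1/2},\qquad(\epsilon_0,\delta,n)\in\Delta .$$ There is an orthonormal basis of the orthogonal complement of $\ker\mathcal D$, labelled by $\Delta$, such that the vector with label $(\epsilon_0,\delta,n)$ is an eigenvector of $\mathcal D$ with this eigenvalue. Here two labels $(\epsilon_0,\delta,n)$ and $(\epsilon_0',\delta',n')$ give the same basis vector if and only if $\epsilon_0=\epsilon_0'$, $\delta_k+n_k=\delta_k'+n_k'$ for all $k$, and $(\delta_k,n_k)=(\delta_k',n_k')$ for every $k$ other than the first index with $(\delta_k,n_k)\ne(0,0)$. (In particular, if only one pair $(\delta_k,n_k)$ is not $(0,0)$, then the vector is determined by $\epsilon_0$, $k$ and $\delta_k+n_k$.) 3. If $\phi$ is an eigenvector of $\mathcal D$ with eigenvalue $E$ (possibly $E=0$), then $\gamma_s\phi$ is an eigenvector of $\mathcal D$ with eigenvalue $-E$. -/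

import Mathlib

open MeasureTheory Topology Filter
open scoped ContDiff ComplexInnerProductSpace

/-- Clifford matrices of the model problem on `S¹ × ℝ³`: real antisymmetric `8 × 8` matrices
`γ₁, γ₂, γ₃` (for `ℝ³`), `γ_s` (for `S¹`) and `ρ₁, ρ₂, ρ₃`, with
`γ_j γ_k + γ_k γ_j = -2 δ_{jk}`, likewise for the `ρ`'s, with `γ_s² = -1`, and with all
seven matrices pairwise anticommuting. -/
structure IsCliffordSystem (γ : Fin 3 → Matrix (Fin 8) (Fin 8) ℝ)
    (γs : Matrix (Fin 8) (Fin 8) ℝ) (ρ : Fin 3 → Matrix (Fin 8) (Fin 8) ℝ) : Prop where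
  γ_antisymm : ∀ k, (γ k).transpose = -γ k
  γs_antisymm : γs.transpose = -γs
  ρ_antisymm : ∀ k, (ρ k).transpose = -ρ k
  γ_γ : ∀ j k, γ j * γ k + γ k * γ j = if j = k then (-2 : ℝ) • 1 else 0
  γs_γs : γs * γs = -1
  γs_γ : ∀ k, γs * γ k + γ k * γs = 0
  ρ_ρ : ∀ j k, ρ j * ρ k + ρ k * ρ j = if j = k then (-2 : ℝ) • 1 else 0
  ρ_γ : ∀ j k, ρ j * γ k + γ k * ρ j = 0
  ρ_γs : ∀ j, ρ j * γs + γs * ρ j = 0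

/-- Euclidean `ℝ³`. -/
abbrev E3 : Type := EuclideanSpace ℝ (Fin 3)

/-- `ℂ⁸ = ℂ⁴ ⊕ ℂ⁴` with its Hermitian norm. -/
abbrev C8 : Type := EuclideanSpace ℂ (Fin 8)

/-- The Hilbert space `𝕃 = L²(ℝ³; ℂ⁸)`. -/
abbrev HilbL : Type := Lp C8 2 (volume : Measure E3)

/-- A real `8 × 8` matrix as a (complex linear) endomorphism of `ℂ⁸`. -/
noncomputable def matC (A : Matrix (Fin 8) (Fin 8) ℝ) : C8 →L[ℂ] C8 :=
  Matrix.toEuclideanCLM (n := Fin 8) (𝕜 := ℂ) (A.map (fun r : ℝ => (r : ℂ)))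

/-- The pointwise action of a real `8 × 8` matrix on `L²(ℝ³; ℂ⁸)`. -/
noncomputable def matL (A : Matrix (Fin 8) (Fin 8) ℝ) : HilbL →L[ℂ] HilbL :=
  (matC A).compLpL 2 (volume : Measure E3)

/-- The partial derivative `∂ψ/∂x_k`. -/
noncomputable def partialDeriv (k : Fin 3) (ψ : E3 → C8) (x : E3) : C8 :=
  fderiv ℝ ψ x (EuclideanSpace.single k (1 : ℝ))

/-- The differential expression
`∑_k γ_k ∂ψ/∂x_k + √2 i R ∑_{j,k} M_{jk} x_j ρ_k ψ`. -/
noncomputable def modelExpr (γ ρ : Fin 3 → Matrix (Fin 8) (Fin 8) ℝ)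
    (M : Matrix (Fin 3) (Fin 3) ℝ) (R : ℝ) (ψ : E3 → C8) (x : E3) : C8 :=
  ∑ k, matC (γ k) (partialDeriv k ψ x) +
    ((Real.sqrt 2 : ℂ) * Complex.I * (R : ℂ)) •
      ∑ j, ∑ k, ((M j k * x j : ℝ) : ℂ) • matC (ρ k) (ψ x)

/-- Smooth compactly supported maps `ℝ³ → ℂ⁸`. -/
def testMaps : Submodule ℂ (E3 → C8) where
  carrier := {ψ | ContDiff ℝ ∞ ψ ∧ HasCompactSupport ψ}
  add_mem' := fun ha hb => ⟨ha.1.add hb.1, ha.2.add hb.2⟩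
  zero_mem' := ⟨contDiff_const, HasCompactSupport.zero⟩
  smul_mem' := fun c _ h => ⟨h.1.const_smul c, h.2.smul_left (f := fun _ => c)⟩

theorem testMaps_memLp (ψ : testMaps) : MemLp (ψ : E3 → C8) 2 (volume : Measure E3) :=
  ψ.2.1.continuous.memLp_of_hasCompactSupport ψ.2.2

theorem testMaps_differentiable (ψ : testMaps) : Differentiable ℝ (ψ : E3 → C8) :=
  ψ.2.1.differentiable (by simp)

theorem modelExpr_memLp (γ ρ : Fin 3 → Matrix (Fin 8) (Fin 8) ℝ)
    (M : Matrix (Fin 3) (Fin 3) ℝ) (R : ℝ) (ψ : testMaps) :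
    MemLp (modelExpr γ ρ M R ψ) 2 (volume : Measure E3) := by
  have hc : Continuous (ψ : E3 → C8) := ψ.2.1.continuous
  have hd : Continuous (fderiv ℝ (ψ : E3 → C8)) := ψ.2.1.continuous_fderiv (by simp)
  refine Continuous.memLp_of_hasCompactSupport ?_ ?_
  · unfold modelExpr partialDeriv
    fun_prop
  · refine HasCompactSupport.intro ψ.2.2 fun x hx => ?_
    have h0 : (ψ : E3 → C8) x = 0 := image_eq_zero_of_notMem_tsupport hx
    have h1 : fderiv ℝ (ψ : E3 → C8) x = 0 := by
      by_contra h
      exact hx (support_fderiv_subset ℝ h)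
    simp [modelExpr, partialDeriv, h0, h1]

/-- The inclusion of test maps in `L²`. -/
noncomputable def testIncl : testMaps →ₗ[ℂ] HilbL where
  toFun ψ := (testMaps_memLp ψ).toLp _
  map_add' _ _ := rfl
  map_smul' _ _ := rfl

/-- The differential expression as a linear map from test maps to `L²`. -/
noncomputable def testModel (γ ρ : Fin 3 → Matrix (Fin 8) (Fin 8) ℝ)
    (M : Matrix (Fin 3) (Fin 3) ℝ) (R : ℝ) : testMaps →ₗ[ℂ] HilbL where
  toFun ψ := (modelExpr_memLp γ ρ M R ψ).toLp _
  map_add' φ ψ := by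
    rw [← MemLp.toLp_add]
    congr 1
    funext x
    have h : fderiv ℝ ((φ : E3 → C8) + (ψ : E3 → C8)) x = fderiv ℝ φ x + fderiv ℝ ψ x :=
      fderiv_add (testMaps_differentiable φ x) (testMaps_differentiable ψ x)
    simp only [modelExpr, partialDeriv, Submodule.coe_add, h, Pi.add_apply,
      _root_.add_apply, map_add, smul_add, Finset.sum_add_distrib]
    abel
  map_smul' c ψ := by
    rw [RingHom.id_apply, ← MemLp.toLp_const_smul]
    congr 1
    funext x
    have h : fderiv ℝ (c • (ψ : E3 → C8)) x = c • fderiv ℝ ψ x :=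
      fderiv_const_smul (testMaps_differentiable ψ x) c
    simp only [modelExpr, partialDeriv, Submodule.coe_smul, h, Pi.smul_apply,
      _root_.smul_apply, map_smul, smul_add, Finset.smul_sum]
    congr 1
    refine Finset.sum_congr rfl fun j _ => Finset.sum_congr rfl fun k _ => ?_
    simp only [smul_smul]
    congr 1
    ring

theorem testIncl_injective : Function.Injective testIncl := by
  intro φ ψ h
  have h' : (φ : E3 → C8) =ᵐ[volume] ψ :=
    (MemLp.toLp_eq_toLp_iff (testMaps_memLp φ) (testMaps_memLp ψ)).1 h
  exact Subtype.ext (Continuous.ae_eq_iff_eq volume φ.2.1.continuous ψ.2.1.continuous |>.1 h')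

/-- The model operator as an unbounded operator on `L²(ℝ³; ℂ⁸)` with domain the smooth compactly
supported maps. -/
noncomputable def modelOpMin (γ ρ : Fin 3 → Matrix (Fin 8) (Fin 8) ℝ)
    (M : Matrix (Fin 3) (Fin 3) ℝ) (R : ℝ) : HilbL →ₗ.[ℂ] HilbL where
  domain := LinearMap.range testIncl
  toFun := testModel γ ρ M R ∘ₗ
    (LinearEquiv.ofInjective testIncl testIncl_injective).symm.toLinearMap

/-- The model operator, as the closure of the operator on smooth compactly supported maps. -/
noncomputable def modelOp (γ ρ : Fin 3 → Matrix (Fin 8) (Fin 8) ℝ)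
    (M : Matrix (Fin 3) (Fin 3) ℝ) (R : ℝ) : HilbL →ₗ.[ℂ] HilbL :=
  (modelOpMin γ ρ M R).closure

section Unbounded

variable {H : Type*} [NormedAddCommGroup H] [InnerProductSpace ℂ H]

/-- The eigenspace `{x ∈ dom T | T x = z x}` of an unbounded operator. -/
def pmapEigenspace (T : H →ₗ.[ℂ] H) (z : ℂ) : Submodule ℂ H where
  carrier := {x | ∃ u : T.domain, (u : H) = x ∧ T u = z • x}
  add_mem' := by
    rintro _ _ ⟨u, rfl, hu⟩ ⟨v, rfl, hv⟩
    exact ⟨u + v, rfl, by rw [T.map_add, hu, hv, smul_add]⟩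
  zero_mem' := ⟨0, rfl, by rw [T.map_zero, smul_zero]⟩
  smul_mem' := by
    rintro c _ ⟨u, rfl, hu⟩
    exact ⟨c • u, rfl, by rw [T.map_smul, hu, smul_comm]⟩

/-- The spectrum of an unbounded operator: the complement of the set of those `z` for which
`T - z` maps the domain of `T` bijectively onto `H` with bounded inverse `S`. -/
def pmapSpectrum (T : H →ₗ.[ℂ] H) : Set ℂ :=
  {z | ¬ ∃ S : H →L[ℂ] H,
    (∀ y, ∃ u : T.domain, (u : H) = S y ∧ T u - z • (u : H) = y) ∧
    ∀ u : T.domain, S (T u - z • (u : H)) = u}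

/-- The spectrum is discrete: it has no accumulation points in `ℂ`, and it consists of
eigenvalues of finite multiplicity. -/
structure HasDiscreteSpectrum (T : H →ₗ.[ℂ] H) : Prop where
  no_accPt : ∀ z : ℂ, ¬ AccPt z (𝓟 (pmapSpectrum T))
  eigenvalue : ∀ z ∈ pmapSpectrum T, pmapEigenspace T z ≠ ⊥
  finite_mult : ∀ z ∈ pmapSpectrum T, FiniteDimensional ℂ (pmapEigenspace T z)

end Unbounded

/-- The positive square roots `λ_k` of the eigenvalues of `Mᵀ M` (listed with multiplicity). -/
noncomputable def singVal (M : Matrix (Fin 3) (Fin 3) ℝ) (k : Fin 3) : ℝ :=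
  Real.sqrt ((Matrix.isHermitian_conjTranspose_mul_self M).eigenvalues k)

/-- The data sets `(ε₀, (δ₁, δ₂, δ₃), (n₁, n₂, n₃))`, not all `δ`'s and `n`'s being zero. -/
structure DataSet where
  sign : ℤˣ
  δ : Fin 3 → Fin 2
  n : Fin 3 → ℕ
  not_all_zero : ¬ ∀ k, δ k = 0 ∧ n k = 0

/-- The sum `δ_k + n_k`. -/
def DataSet.level (d : DataSet) (k : Fin 3) : ℕ := (d.δ k : ℕ) + d.n k

/-- The number `ε₀ (2√2 R ∑_k (δ_k + n_k) λ_k)^{1/2}`. -/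
noncomputable def DataSet.energy (M : Matrix (Fin 3) (Fin 3) ℝ) (R : ℝ) (d : DataSet) : ℝ :=
  ((d.sign : ℤ) : ℝ) * Real.sqrt (2 * Real.sqrt 2 * R * ∑ k, (d.level k : ℝ) * singVal M k)

/-- Two data sets are equivalent when they have the same `ε₀`, the same sums `δ_k + n_k`, and the
same `(δ_k, n_k)` except possibly at the first index `k` with `(δ_k, n_k) ≠ (0, 0)`. In particular,
if only one pair is nonzero, then only `ε₀` and the sum of that pair matter. -/
def DataSet.Equiv (d d' : DataSet) : Prop :=
  d.sign = d'.sign ∧ (∀ k, d.level k = d'.level k) ∧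
    ∀ k, (∃ j < k, d.level j ≠ 0) → d.δ k = d'.δ k ∧ d.n k = d'.n k

/-!
The model operator is a supersymmetric harmonic oscillator, and it is diagonalized explicitly.

Choose an orthonormal basis `v` of eigenvectors of `Mᵀ M` and put `u_a = λ_a⁻¹ M v_a`
(`exists_singular_bases`). With `γ'_a = ∑ u_a(k) γ_k` and `ρ'_a = ∑ v_a(k) ρ_k`, which together with
`γ_s` again form a Clifford system (`IsCliffordSystem.rotate`), the operator becomes a sum
`𝒟 = ∑ D_a` of three symmetric, pairwise anticommuting one-dimensional Dirac operators
`D_a = γ'_a ∂_{u_a} + i w_a ⟪u_a, x⟫ ρ'_a`, where `w_a = √2 R λ_a` (`sum_diracComponent_apply`).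

The chiralities `i γ'_a ρ'_a` are commuting Hermitian involutions, and the eight joint eigenspinors
`spinor δ` are obtained from one of them by applying the `γ'_a`. On the Hermite state with exponents
`n` and spinor `δ`, the operator `D_a` is a raising or lowering operator that flips `δ_a`, whence
`D_a²` acts by `2 w_a (δ_a + n_a)` (`diracComponent_sq`). The Hermite states are orthogonal, and they
are total in `L²`: a function orthogonal to all of them has, multiplied by the Gaussian, a Fourier
transform whose power series vanishes (`closure_span_hermiteState_eq_top`). These facts are
collected in `IsCliffordSystem.isLadder`.

The rest of the diagonalization is algebra, done for any `IsLadder`. As the `D_a` anticommute,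
`𝒟² = ∑ D_a²` acts by `E² = ∑ 2 w_k (δ_k + n_k)`. Let `a` be the first index with `δ_a + n_a ≠ 0`.
For a state `ψ` with `δ_a = 0` and a sign `ε`, the vector `(E + ε 𝒟) (e + ε D_a) ψ` with
`e² = 2 w_a n_a` is an eigenvector of `𝒟` with eigenvalue `ε E`. The relation
`𝒟 D_a + D_a 𝒟 = 2 D_a²` yields `P_{D_a} P_𝒟 P_{D_a} = c P_{D_a}` and `P_𝒟 P_{D_a} P_𝒟 = c P_𝒟` with
`c > 0` for the unnormalized sign projections (`signProj_sandwich`, `signProj_sandwich'`). The first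
identity shows that distinct states give orthogonal nonzero vectors, the second one that these
vectors exhaust the space (`IsLadder.exists_eigenbasis`). Replacing a state with `δ_a = 1` by its
partner with `δ_a = 0` and the same levels is exactly the identification of labels in
`DataSet.Equiv`.

Finally, cutting off Schwartz functions shows that the closure of the operator on test maps contains
this eigenbasis, and a closed operator which contains an eigenbasis and is symmetric on it is the
maximal diagonal operator (`isDiagonalIn_modelOp`). Self-adjointness, discreteness of the spectrum
and the description of the eigenspaces are read off from that; the symmetry of the spectrum holds
because `γ_s` anticommutes with all `D_a`.
-/

/-! ### Unbounded operators with an orthonormal eigenbasis -/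

section Diagonal

variable {H : Type*} [NormedAddCommGroup H] [InnerProductSpace ℂ H]
variable {ι : Type*}

/-- The unbounded operator `T` is the maximal diagonal operator with eigenvalues `μ` in the
Hilbert basis `b`: a pair `(x, y)` lies in its graph exactly when the coordinates of `y` are `μ i`
times those of `x`. -/
def IsDiagonalIn (T : H →ₗ.[ℂ] H) (b : HilbertBasis ι ℂ H) (μ : ι → ℝ) : Prop :=
  ∀ x y, (x, y) ∈ T.graph ↔ ∀ i, inner ℂ (b i) y = (μ i : ℂ) * inner ℂ (b i) x

theorem HilbertBasis.ext_inner {b : HilbertBasis ι ℂ H} {x y : H}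
    (h : ∀ i, inner ℂ (b i) x = inner ℂ (b i) y) : x = y := by
  apply b.repr.injective
  ext i
  rw [b.repr_apply_apply, b.repr_apply_apply, h i]

/-- A closed subspace of `H × H` containing all `(b i, μ i • b i)`, and compatible with these
eigenvalues on coordinates, contains every pair whose coordinates are so related: such a pair is the
limit of its finite partial expansions. -/
theorem mem_iff_of_eigenbasis {G : Submodule ℂ (H × H)} (hG : IsClosed (G : Set (H × H)))
    {b : HilbertBasis ι ℂ H} {μ : ι → ℝ} (hb : ∀ i, (b i, (μ i : ℂ) • b i) ∈ G)
    (hcoef : ∀ p ∈ G, ∀ i, inner ℂ (b i) p.2 = (μ i : ℂ) * inner ℂ (b i) p.1) (x y : H) :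
    (x, y) ∈ G ↔ ∀ i, inner ℂ (b i) y = (μ i : ℂ) * inner ℂ (b i) x := by
  refine ⟨fun h => hcoef _ h, fun h => ?_⟩
  have hx := b.hasSum_repr x
  have hy := b.hasSum_repr y
  have hxy := hx.prodMk hy
  refine hG.mem_of_tendsto hxy (Eventually.of_forall fun s => ?_)
  refine G.sum_mem fun i _ => ?_
  rw [b.repr_apply_apply, b.repr_apply_apply, h i]
  have := G.smul_mem (inner ℂ (b i) x) (hb i)
  rwa [Prod.smul_mk, smul_smul, mul_comm] at this

variable {T : H →ₗ.[ℂ] H} {b : HilbertBasis ι ℂ H} {μ : ι → ℝ}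

theorem IsDiagonalIn.basis_mem (h : IsDiagonalIn T b μ) (i : ι) :
    (b i, (μ i : ℂ) • b i) ∈ T.graph := by
  rw [h]
  intro j
  rw [inner_smul_right]
  by_cases hij : j = i
  · subst hij; rfl
  · rw [b.orthonormal.2 hij]; simp

theorem mem_pmapEigenspace_iff {z : ℂ} {x : H} :
    x ∈ pmapEigenspace T z ↔ (x, z • x) ∈ T.graph := by
  rw [LinearPMap.mem_graph_iff]; rfl

theorem IsDiagonalIn.mem_eigenspace_iff (h : IsDiagonalIn T b μ) (z : ℂ) (x : H) :
    x ∈ pmapEigenspace T z ↔ ∀ i, (μ i : ℂ) = z ∨ inner ℂ (b i) x = 0 := by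
  rw [mem_pmapEigenspace_iff, h]
  refine forall_congr' fun i => ?_
  rw [inner_smul_right]
  constructor
  · intro hi
    rcases eq_or_ne (inner ℂ (b i) x) 0 with h0 | h0
    · exact Or.inr h0
    · exact Or.inl (mul_right_cancel₀ h0 hi).symm
  · rintro (hi | hi)
    · rw [hi]
    · simp [hi]

theorem IsDiagonalIn.basis_mem_eigenspace (h : IsDiagonalIn T b μ) (i : ι) :
    b i ∈ pmapEigenspace T (μ i) := by
  rw [h.mem_eigenspace_iff]
  intro j
  by_cases hij : j = i
  · exact Or.inl (by rw [hij])
  · exact Or.inr (b.orthonormal.2 hij)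

theorem IsDiagonalIn.eigenspace_ne_bot_iff (h : IsDiagonalIn T b μ) (z : ℂ) :
    pmapEigenspace T z ≠ ⊥ ↔ ∃ i, z = (μ i : ℂ) := by
  constructor
  · intro hz
    by_contra! hne
    refine hz ((Submodule.eq_bot_iff _).2 fun x hx => ?_)
    rw [h.mem_eigenspace_iff] at hx
    refine HilbertBasis.ext_inner (b := b) fun i => ?_
    rw [inner_zero_right]
    exact (hx i).resolve_left (hne i).symm
  · rintro ⟨i, rfl⟩ h0
    have := h.basis_mem_eigenspace i
    rw [h0, Submodule.mem_bot] at this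
    exact b.orthonormal.ne_zero i this

theorem IsDiagonalIn.eigenspace_eq_span (h : IsDiagonalIn T b μ) (z : ℂ)
    (hfin : {i | (μ i : ℂ) = z}.Finite) :
    pmapEigenspace T z = Submodule.span ℂ (b '' {i | (μ i : ℂ) = z}) := by
  apply le_antisymm
  · intro x hx
    rw [h.mem_eigenspace_iff] at hx
    have hx' : x = ∑ i ∈ hfin.toFinset, inner ℂ (b i) x • b i := by
      have h1 := b.hasSum_repr x
      simp only [b.repr_apply_apply] at h1
      refine h1.unique (hasSum_sum_of_ne_finset_zero fun i hi => ?_)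
      rw [(hx i).resolve_left (by simpa using hi), zero_smul]
    rw [hx']
    refine Submodule.sum_mem _ fun i hi => Submodule.smul_mem _ _ (Submodule.subset_span ?_)
    exact ⟨i, by simpa using hi, rfl⟩
  · rw [Submodule.span_le]
    rintro _ ⟨i, hi, rfl⟩
    have := h.basis_mem_eigenspace i
    rwa [show (μ i : ℂ) = z from hi] at this

theorem IsDiagonalIn.dense_domain (h : IsDiagonalIn T b μ) : Dense (T.domain : Set H) := by
  have hle : Submodule.span ℂ (Set.range b) ≤ T.domain := by
    rw [Submodule.span_le]
    rintro _ ⟨i, rfl⟩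
    exact LinearPMap.mem_domain_of_mem_graph (h.basis_mem i)
  have hd : Dense ((Submodule.span ℂ (Set.range b) : Submodule ℂ H) : Set H) := by
    rw [Submodule.dense_iff_topologicalClosure_eq_top]; exact b.dense_span
  exact hd.mono hle

theorem IsDiagonalIn.isSelfAdjoint [CompleteSpace H] (h : IsDiagonalIn T b μ) :
    IsSelfAdjoint T := by
  rw [LinearPMap.isSelfAdjoint_def]
  apply LinearPMap.eq_of_eq_graph
  rw [LinearPMap.adjoint_graph_eq_graph_adjoint h.dense_domain]
  ext ⟨x, y⟩
  rw [Submodule.mem_adjoint_iff, h]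
  constructor
  · intro hxy i
    have := hxy _ _ (h.basis_mem i)
    rw [sub_eq_zero, inner_smul_left, Complex.conj_ofReal] at this
    exact this.symm
  · intro hxy u v huv
    rw [h] at huv
    rw [sub_eq_zero, ← b.tsum_inner_mul_inner, ← b.tsum_inner_mul_inner]
    congr 1
    funext i
    have h1 := huv i
    have h2 : inner ℂ v (b i) = (μ i : ℂ) * inner ℂ u (b i) := by
      rw [← inner_conj_symm, h1, map_mul, Complex.conj_ofReal, inner_conj_symm]
    dsimp only
    rw [h2, hxy i]; ring

/-- Bounded families of scalars define bounded diagonal operators: the operator with entries `c i`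
in a Hilbert basis. -/
theorem HilbertBasis.exists_diagonal [CompleteSpace H] (b : HilbertBasis ι ℂ H) (c : ι → ℂ) (C : ℝ)
    (hc : ∀ i, ‖c i‖ ≤ C) :
    ∃ S : H →L[ℂ] H, ∀ i x, inner ℂ (b i) (S x) = c i * inner ℂ (b i) x := by
  have hmem : ∀ x : H, Memℓp (fun i => c i * b.repr x i) 2 := by
    intro x
    have h1 : Summable fun i => ‖b.repr x i‖ ^ (2 : ENNReal).toReal :=
      (memℓp_gen_iff (by norm_num)).1 (lp.memℓp (b.repr x))
    refine memℓp_gen ?_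
    refine Summable.of_nonneg_of_le (fun i => by positivity) (fun i => ?_)
      (h1.mul_left (C ^ (2 : ENNReal).toReal))
    rw [norm_mul, Real.mul_rpow (norm_nonneg _) (norm_nonneg _)]
    gcongr
    exact hc i
  have hex : ∀ x : H, ∃ y : H, ∀ i, inner ℂ (b i) y = c i * inner ℂ (b i) x := fun x =>
    ⟨b.repr.symm ⟨_, hmem x⟩, fun i => by
      rw [← b.repr_apply_apply, ← b.repr_apply_apply, LinearIsometryEquiv.apply_symm_apply]⟩
  choose S hS using hex
  let L : H →ₗ[ℂ] H :=
    { toFun := S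
      map_add' := fun x y => HilbertBasis.ext_inner (b := b) fun i => by
        rw [hS, inner_add_right, inner_add_right, hS, hS, mul_add]
      map_smul' := fun z x => HilbertBasis.ext_inner (b := b) fun i => by
        rw [hS, RingHom.id_apply, inner_smul_right, inner_smul_right, hS]; ring }
  have hcl : IsClosed (L.graph : Set (H × H)) := by
    have : (L.graph : Set (H × H)) =
        ⋂ i, {p : H × H | inner ℂ (b i) p.2 = c i * inner ℂ (b i) p.1} := by
      ext ⟨x, y⟩
      simp only [SetLike.mem_coe, LinearMap.mem_graph_iff, Set.mem_iInter, Set.mem_ofPred_eq]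
      constructor
      · rintro rfl i; exact hS x i
      · intro hxy
        exact HilbertBasis.ext_inner (b := b) fun i => by rw [hxy i]; exact (hS x i).symm
    rw [this]
    exact isClosed_iInter fun i => isClosed_eq (by fun_prop) (by fun_prop)
  exact ⟨⟨L, L.continuous_of_isClosed_graph hcl⟩, fun i x => hS x i⟩

/-- If the eigenvalues have no finite limit points, every other number is in the resolvent set, the
resolvent being the diagonal operator with entries `(μ i - z)⁻¹`. -/
theorem IsDiagonalIn.spectrum_subset [CompleteSpace H] (h : IsDiagonalIn T b μ)
    (hfin : ∀ C : ℝ, {i | |μ i| ≤ C}.Finite) :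
    pmapSpectrum T ⊆ Set.range fun i => (μ i : ℂ) := by
  intro z hz
  by_contra hne
  apply hz
  -- Only finitely many `μ i` lie within distance one of `z`, hence `z` has positive distance to all.
  obtain ⟨r, hr, hrz⟩ : ∃ r : ℝ, 0 < r ∧ ∀ i, r ≤ ‖(μ i : ℂ) - z‖ := by
    have hF : {i | ‖(μ i : ℂ) - z‖ < 1}.Finite := by
      refine (hfin (‖z‖ + 1)).subset fun i hi => ?_
      have h1 : ‖(μ i : ℂ)‖ ≤ ‖(μ i : ℂ) - z‖ + ‖z‖ := by
        simpa using norm_add_le ((μ i : ℂ) - z) z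
      rw [Complex.norm_real, Real.norm_eq_abs] at h1
      have h2 : ‖(μ i : ℂ) - z‖ < 1 := hi
      simp only [Set.mem_ofPred_eq]
      linarith
    rcases hF.toFinset.eq_empty_or_nonempty with he | hne'
    · refine ⟨1, one_pos, fun i => ?_⟩
      by_contra! hi
      have : i ∈ hF.toFinset := by simpa using hi
      simp [he] at this
    · obtain ⟨j, hj, hmin⟩ := hF.toFinset.exists_min_image (fun i => ‖(μ i : ℂ) - z‖) hne'
      refine ⟨‖(μ j : ℂ) - z‖, ?_, fun i => ?_⟩
      · rw [norm_pos_iff, sub_ne_zero]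
        exact fun h0 => hne ⟨j, h0⟩
      · by_cases hi : ‖(μ i : ℂ) - z‖ < 1
        · exact hmin i (by simpa using hi)
        · have hj' : ‖(μ j : ℂ) - z‖ < 1 := by simpa using hj
          linarith
  have hne0 : ∀ i, (μ i : ℂ) - z ≠ 0 := fun i h0 => by
    have := hrz i
    rw [h0, norm_zero] at this
    linarith
  obtain ⟨S, hS⟩ := b.exists_diagonal (fun i => ((μ i : ℂ) - z)⁻¹) r⁻¹ fun i => by
    rw [norm_inv]; exact inv_anti₀ hr (hrz i)
  refine ⟨S, fun y => ?_, fun u => ?_⟩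
  · have hmem : (S y, y + z • S y) ∈ T.graph := by
      rw [h]
      intro i
      rw [inner_add_right, inner_smul_right, hS]
      have := hne0 i
      field_simp
      ring
    obtain ⟨u, hu, hu'⟩ := (LinearPMap.mem_graph_iff T).1 hmem
    refine ⟨u, hu, ?_⟩
    rw [hu', hu]; simp
  · refine HilbertBasis.ext_inner (b := b) fun i => ?_
    have h1 := (h _ _).1 (LinearPMap.mem_graph T u) i
    rw [hS, inner_sub_right, inner_smul_right, h1, ← sub_mul, inv_mul_cancel_left₀ (hne0 i)]

theorem IsDiagonalIn.hasDiscreteSpectrum [CompleteSpace H] (h : IsDiagonalIn T b μ)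
    (hfin : ∀ C : ℝ, {i | |μ i| ≤ C}.Finite) : HasDiscreteSpectrum T where
  no_accPt := by
    intro z hz
    have hsub := h.spectrum_subset hfin
    have hF : (Metric.closedBall z 1 ∩ pmapSpectrum T).Finite := by
      refine ((hfin (‖z‖ + 1)).image fun i => (μ i : ℂ)).subset ?_
      rintro w ⟨hw, hw'⟩
      obtain ⟨i, rfl⟩ := hsub hw'
      refine ⟨i, ?_, rfl⟩
      rw [mem_closedBall_iff_norm] at hw
      have h1 : ‖(μ i : ℂ)‖ ≤ ‖(μ i : ℂ) - z‖ + ‖z‖ := by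
        simpa using norm_add_le ((μ i : ℂ) - z) z
      rw [Complex.norm_real, Real.norm_eq_abs] at h1
      simp only [Set.mem_ofPred_eq]
      linarith
    rw [accPt_iff_nhds] at hz
    have hU : Metric.closedBall z 1 ∩ ((Metric.closedBall z 1 ∩ pmapSpectrum T) \ {z})ᶜ ∈ 𝓝 z := by
      refine inter_mem (Metric.closedBall_mem_nhds z one_pos) ?_
      exact (hF.subset Set.sdiff_subset).isClosed.isOpen_compl.mem_nhds fun hh => hh.2 rfl
    obtain ⟨w, ⟨⟨hw1, hw2⟩, hw3⟩, hwz⟩ := hz _ hU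
    exact hw2 ⟨⟨hw1, hw3⟩, hwz⟩
  eigenvalue := fun z hz => by
    rw [h.eigenspace_ne_bot_iff]
    obtain ⟨i, hi⟩ := h.spectrum_subset hfin hz
    exact ⟨i, hi.symm⟩
  finite_mult := fun z _ => by
    have hF : {i | (μ i : ℂ) = z}.Finite := by
      refine (hfin ‖z‖).subset fun i hi => ?_
      have hi' : (μ i : ℂ) = z := hi
      simp [← hi']
    rw [h.eigenspace_eq_span z hF]
    exact FiniteDimensional.span_of_finite ℂ (hF.image _)

/-- The basis vectors with nonzero eigenvalue span a dense subspace of the orthogonal complement of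
the kernel. -/
theorem IsDiagonalIn.closure_span_eq [CompleteSpace H] (h : IsDiagonalIn T b μ) :
    (Submodule.span ℂ (b '' {i | μ i ≠ 0})).topologicalClosure = (pmapEigenspace T 0)ᗮ := by
  rw [← Submodule.orthogonal_orthogonal_eq_closure]
  congr 1
  ext x
  rw [h.mem_eigenspace_iff, Submodule.mem_orthogonal]
  refine ⟨fun hx i => or_iff_not_imp_left.2 fun hi => hx _ (Submodule.subset_span
    ⟨i, fun h0 => hi (by rw [h0, Complex.ofReal_zero]), rfl⟩), fun hx y hy => ?_⟩
  induction hy using Submodule.span_induction with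
  | mem y hy =>
    obtain ⟨i, hi, rfl⟩ := hy
    exact (hx i).resolve_left fun h0 => hi (by exact_mod_cast h0)
  | zero => exact inner_zero_left _
  | add y z _ _ hy hz => rw [inner_add_left, hy, hz, add_zero]
  | smul c y _ hy => rw [inner_smul_left, hy, mul_zero]

end Diagonal

/-! ### Diagonalizing a sum of anticommuting symmetric operators -/

section Projections

variable {X : Type*} [AddCommGroup X] [Module ℂ X] {A D : X →ₗ[ℂ] X} {e E ε : ℂ}

/-- `E + ε T`, which up to the factor `1 / (2E)` is the projection onto the `ε E`-eigenspace of `T`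
wherever `T ^ 2 = E ^ 2` and `ε ^ 2 = 1`. -/
def signProj (T : X →ₗ[ℂ] X) (E ε : ℂ) : X →ₗ[ℂ] X := E • LinearMap.id + ε • T

theorem signProj_apply (T : X →ₗ[ℂ] X) (E ε : ℂ) (x : X) :
    signProj T E ε x = E • x + ε • T x := rfl

theorem apply_signProj (hε : ε * ε = 1) {x : X} (hD : D (D x) = (E * E) • x) :
    D (signProj D E ε x) = (ε * E) • signProj D E ε x := by
  simp only [signProj_apply, map_add, map_smul, hD]
  have h2 : (ε * E * ε) • D x = E • D x := by
    rw [show ε * E * ε = ε * ε * E by ring, hε, one_mul]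
  simp only [smul_add, smul_smul, h2]
  rw [show ε * (E * E) = ε * E * E by ring]
  abel

/-- If `A² = e²`, `D² = E²` and `A D + D A = 2 A²`, then the spectral projections of `A` and of `D`
reproduce each other: `P_A P_D P_A = 2 e (E + e) P_A`. -/
theorem signProj_sandwich (hε : ε * ε = 1) {x : X} (hA : A (A x) = (e * e) • x)
    (hAD : ∀ y, A (D y) + D (A y) = (2 : ℂ) • A (A y)) :
    signProj A e ε (signProj D E ε (signProj A e ε x)) =
      (2 * e * (E + e)) • signProj A e ε x := by
  have h1 : A (D x) = (2 * (e * e)) • x - D (A x) := by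
    rw [eq_sub_iff_add_eq, hAD, hA, smul_smul]
  have h2 : A (D (A x)) = (2 * (e * e)) • A x - (e * e) • D x := by
    have := hAD (A x)
    rw [hA, map_smul, map_smul, smul_smul] at this
    rw [eq_sub_iff_add_eq, this]
  simp only [signProj_apply, map_add, map_smul, hA, h1, h2, smul_add, smul_sub, smul_smul]
  rcases mul_self_eq_one_iff.1 hε with rfl | rfl <;> module

/-- The companion of `signProj_sandwich` with the roles of the two operators exchanged:
`P_D P_A P_D = 2 e (E + e) P_D`. -/
theorem signProj_sandwich' (hε : ε * ε = 1) {x : X} (hA : A (A x) = (e * e) • x)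
    (hD : D (D x) = (E * E) • x)
    (hAD : ∀ y, A (D y) + D (A y) = (2 : ℂ) • A (A y))
    (hDA : D (D (A x)) = (E * E) • A x) :
    signProj D E ε (signProj A e ε (signProj D E ε x)) =
      (2 * e * (E + e)) • signProj D E ε x := by
  have h1 : A (D x) = (2 * (e * e)) • x - D (A x) := by
    rw [eq_sub_iff_add_eq, hAD, hA, smul_smul]
  simp only [signProj_apply, map_add, map_smul, map_sub, hD, h1, hDA, smul_add, smul_sub,
    smul_smul]
  rcases mul_self_eq_one_iff.1 hε with rfl | rfl <;> module

theorem signProj_signProj (hε : ε * ε = 1) {x : X} (hD : D (D x) = (E * E) • x) :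
    signProj D E ε (signProj D E ε x) = (2 * E) • signProj D E ε x := by
  simp only [signProj_apply, map_add, map_smul, hD, smul_add, smul_smul]
  rcases mul_self_eq_one_iff.1 hε with rfl | rfl <;> module

/-- An eigenvector of `A` for the sign `ε` is recovered from `A x`. -/
theorem signProj_apply_apply (hε : ε * ε = 1) {x : X} (hA : A (A x) = (e * e) • x) :
    signProj A e ε (A x) = (ε * e) • signProj A e ε x := by
  simp only [signProj_apply, hA, smul_add, smul_smul]
  rcases mul_self_eq_one_iff.1 hε with rfl | rfl <;> module

end Projections

section DataSets

theorem DataSet.ext' {d d' : DataSet} (hs : d.sign = d'.sign) (hδ : d.δ = d'.δ)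
    (hn : d.n = d'.n) : d = d' := by
  cases d; cases d'; simp_all

theorem DataSet.exists_level_ne_zero (d : DataSet) : ∃ k, d.level k ≠ 0 := by
  by_contra! h
  refine d.not_all_zero fun k => ?_
  have := h k
  unfold DataSet.level at this
  exact ⟨Fin.ext (by simp; omega), by omega⟩

/-- The first index at which the level of a nonzero family of levels does not vanish. -/
noncomputable def firstIndex (N : Fin 3 → ℕ) (h : ∃ k, N k ≠ 0) : Fin 3 :=
  (Finset.univ.filter fun k => N k ≠ 0).min' (by
    obtain ⟨k, hk⟩ := h; exact ⟨k, by simpa using hk⟩)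

theorem firstIndex_ne_zero (N : Fin 3 → ℕ) (h : ∃ k, N k ≠ 0) : N (firstIndex N h) ≠ 0 := by
  have := Finset.min'_mem (Finset.univ.filter fun k => N k ≠ 0) (by
    obtain ⟨k, hk⟩ := h; exact ⟨k, by simpa using hk⟩)
  exact (Finset.mem_filter.1 this).2

theorem firstIndex_le (N : Fin 3 → ℕ) (h : ∃ k, N k ≠ 0) {k : Fin 3} (hk : N k ≠ 0) :
    firstIndex N h ≤ k :=
  Finset.min'_le _ _ (by simpa using hk)

/-- The first index `k` with `(δ_k, n_k) ≠ (0, 0)`. -/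
noncomputable def DataSet.first (d : DataSet) : Fin 3 := firstIndex d.level d.exists_level_ne_zero

theorem DataSet.level_first_ne_zero (d : DataSet) : d.level d.first ≠ 0 :=
  firstIndex_ne_zero _ _

theorem DataSet.first_le (d : DataSet) {k : Fin 3} (hk : d.level k ≠ 0) : d.first ≤ k :=
  firstIndex_le _ _ hk

theorem DataSet.first_congr {d d' : DataSet} (h : ∀ k, d.level k = d'.level k) :
    d.first = d'.first := by
  unfold DataSet.first
  congr 1
  exact funext h

/-- Equivalence of labels, spelled out at the first nonvanishing index: away from it the data
agree, and at it the levels do. -/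
theorem DataSet.equiv_iff (d d' : DataSet) : d.Equiv d' ↔
    d.sign = d'.sign ∧ (∀ k, d.level k = d'.level k) ∧
      ∀ k, k ≠ d.first → d.δ k = d'.δ k := by
  unfold DataSet.Equiv
  refine and_congr_right fun _ => and_congr_right fun hl => ⟨fun h k hk => ?_, fun h k hk => ?_⟩
  · rcases lt_or_gt_of_ne hk with hlt | hgt
    · have h0 : d.level k = 0 := by
        by_contra h0
        exact absurd (d.first_le h0) (not_le.2 hlt)
      have h0' := hl k
      rw [h0] at h0'
      unfold DataSet.level at h0 h0'
      exact Fin.ext (by omega)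
    · exact (h k ⟨_, hgt, d.level_first_ne_zero⟩).1
  · obtain ⟨j, hj, hj0⟩ := hk
    have hδ := h k fun hh => absurd (d.first_le hj0) (not_le.2 (hh ▸ hj))
    refine ⟨hδ, ?_⟩
    have := hl k
    unfold DataSet.level at this
    rw [hδ] at this
    omega

/-- The representative of the class of a label that has `δ = 0` at the first nonvanishing index. -/
noncomputable def DataSet.canon (d : DataSet) : DataSet where
  sign := d.sign
  δ := Function.update d.δ d.first 0
  n := Function.update d.n d.first (d.level d.first)
  not_all_zero := fun h => d.level_first_ne_zero (by simpa using (h d.first).2)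

theorem DataSet.canon_level (d : DataSet) (k : Fin 3) : d.canon.level k = d.level k := by
  by_cases hk : k = d.first
  · subst hk; simp [DataSet.level, DataSet.canon]
  · simp [DataSet.level, DataSet.canon, hk]

theorem DataSet.canon_first (d : DataSet) : d.canon.first = d.first :=
  DataSet.first_congr d.canon_level

theorem DataSet.canon_δ_first (d : DataSet) : d.canon.δ d.canon.first = 0 := by
  rw [canon_first]; simp [DataSet.canon]

theorem DataSet.canon_eq_self {d : DataSet} (h : d.δ d.first = 0) : d.canon = d := by
  refine DataSet.ext' rfl ?_ ?_
  · simp [DataSet.canon, ← h]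
  · simp [DataSet.canon, DataSet.level, h]

theorem DataSet.equiv_iff_canon_eq (d d' : DataSet) : d.Equiv d' ↔ d.canon = d'.canon := by
  rw [DataSet.equiv_iff]
  constructor
  · rintro ⟨hs, hl, hδ⟩
    have hf := DataSet.first_congr hl
    refine DataSet.ext' hs ?_ ?_
    · funext k
      by_cases hk : k = d.first
      · simp only [DataSet.canon, ← hf]; subst hk; simp
      · have := hδ k hk
        simp only [DataSet.canon, ← hf, Function.update_of_ne hk, this]
    · funext k
      by_cases hk : k = d.first
      · simp only [DataSet.canon, ← hf, ← hl]; subst hk; simp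
      · have h1 := hδ k hk
        have h2 := hl k
        simp only [DataSet.canon, ← hf, Function.update_of_ne hk]
        unfold DataSet.level at h2
        rw [h1] at h2
        omega
  · intro h
    have hl : ∀ k, d.level k = d'.level k := fun k => by
      rw [← d.canon_level, h, d'.canon_level]
    have hf := DataSet.first_congr hl
    refine ⟨show d.canon.sign = d'.canon.sign by rw [h], hl, fun k hk => ?_⟩
    have := congrFun (congrArg DataSet.δ h) k
    simpa only [DataSet.canon, ← hf, Function.update_of_ne hk] using this

end DataSets

section Ladder

variable {X : Type*} [AddCommGroup X] [Module ℂ X]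
variable {H : Type*} [NormedAddCommGroup H] [InnerProductSpace ℂ H]

/-- A linear operator on `X` is symmetric for the inner product pulled back along `ι : X → H`. -/
def SymmetricVia (ι : X →ₗ[ℂ] H) (S : X →ₗ[ℂ] X) : Prop :=
  ∀ x y, inner ℂ (ι (S x)) (ι y) = inner ℂ (ι x) (ι (S y))

theorem SymmetricVia.inner_eq_zero {ι : X →ₗ[ℂ] H} {S : X →ₗ[ℂ] X} (hS : SymmetricVia ι S)
    {x y : X} {μ ν : ℝ} (hx : S x = (μ : ℂ) • x) (hy : S y = (ν : ℂ) • y) (hne : μ ≠ ν) :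
    inner ℂ (ι x) (ι y) = 0 := by
  have h := hS x y
  rw [hx, hy, map_smul, map_smul, inner_smul_left, inner_smul_right, Complex.conj_ofReal] at h
  by_contra h0
  exact hne (Complex.ofReal_injective (mul_right_cancel₀ h0 h))

theorem SymmetricVia.comp_self {ι : X →ₗ[ℂ] H} {S : X →ₗ[ℂ] X} (hS : SymmetricVia ι S) :
    SymmetricVia ι (S ∘ₗ S) := fun x y => by
  simp only [LinearMap.comp_apply]; rw [hS, hS]

theorem SymmetricVia.sum {ι : X →ₗ[ℂ] H} {κ : Type*} {s : Finset κ} {S : κ → X →ₗ[ℂ] X}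
    (hS : ∀ a, SymmetricVia ι (S a)) : SymmetricVia ι (∑ a ∈ s, S a) := fun x y => by
  simp only [LinearMap.sum_apply, map_sum, sum_inner, inner_sum, hS _ x y]

theorem SymmetricVia.signProj {ι : X →ₗ[ℂ] H} {S : X →ₗ[ℂ] X} (hS : SymmetricVia ι S)
    (E ε : ℝ) : SymmetricVia ι (signProj S E ε) := fun x y => by
  simp only [signProj_apply, map_add, map_smul, inner_add_left, inner_add_right, inner_smul_left,
    inner_smul_right, Complex.conj_ofReal, hS x y]

/-- Three pairwise anticommuting symmetric operators `A a`, together with a total orthogonal family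
of states `ψ n δ` on which `(A a) ^ 2` acts by `2 w a (n a + δ a)`. Each `A a` annihilates the states
of level zero at `a`, and otherwise sends a state to a multiple of another one, of the same levels,
with `δ a` flipped and the other `δ` unchanged. -/
structure IsLadder (ι : X →ₗ[ℂ] H) (A : Fin 3 → X →ₗ[ℂ] X) (w : Fin 3 → ℝ)
    (ψ : (Fin 3 → ℕ) → (Fin 3 → Fin 2) → X) : Prop where
  pos : ∀ a, 0 < w a
  symm : ∀ a, SymmetricVia ι (A a)
  anti : ∀ a b, a ≠ b → ∀ x, A a (A b x) = -A b (A a x)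
  sq : ∀ a n δ, A a (A a (ψ n δ)) = ((2 * w a * (δ a + n a : ℕ) : ℝ) : ℂ) • ψ n δ
  vanish : ∀ a n δ, (δ a + n a : ℕ) = 0 → A a (ψ n δ) = 0
  flip : ∀ a n δ, (δ a + n a : ℕ) ≠ 0 → ∃ (κ : ℂ) (n' : Fin 3 → ℕ) (δ' : Fin 3 → Fin 2),
    A a (ψ n δ) = κ • ψ n' δ' ∧ (∀ k, (δ' k + n' k : ℕ) = δ k + n k) ∧ δ' a ≠ δ a ∧
      ∀ k, k ≠ a → δ' k = δ k
  orth : ∀ n δ n' δ', (n, δ) ≠ (n', δ') → inner ℂ (ι (ψ n δ)) (ι (ψ n' δ')) = 0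
  ne_zero : ∀ n δ, ι (ψ n δ) ≠ 0
  total : (Submodule.span ℂ (Set.range fun p : (Fin 3 → ℕ) × (Fin 3 → Fin 2) =>
    ι (ψ p.1 p.2))).topologicalClosure = ⊤

/-- The joint eigenspace of the operators `(A a) ^ 2` for the eigenvalues `2 w a N a`. -/
def levelSpace (A : Fin 3 → X →ₗ[ℂ] X) (w : Fin 3 → ℝ) (N : Fin 3 → ℕ) : Submodule ℂ X where
  carrier := {x | ∀ a, A a (A a x) = ((2 * w a * N a : ℝ) : ℂ) • x}
  add_mem' := fun hx hy a => by rw [map_add, map_add, hx a, hy a, smul_add]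
  zero_mem' := fun a => by simp
  smul_mem' := fun c x hx a => by rw [map_smul, map_smul, hx a, smul_comm]

/-- The squared modulus `∑ 2 w_k N_k` of the energies in the level space `N`. -/
def levelEnergySq (w : Fin 3 → ℝ) (N : Fin 3 → ℕ) : ℝ := ∑ k, 2 * w k * N k

/-- The labels with `δ = 0` at the first nonvanishing index: one for each class of labels. -/
abbrev CanonLabel : Type := {d : DataSet // d.δ d.first = 0}

/-- The eigenvalue belonging to a label; the extra label `none` stands for the vacuum. -/
noncomputable def labelEnergy (w : Fin 3 → ℝ) : Option CanonLabel → ℝ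
  | none => 0
  | some d => ((d.1.sign : ℤ) : ℝ) * Real.sqrt (levelEnergySq w d.1.level)

theorem DataSet.sign_mul_self (d : DataSet) :
    (((d.sign : ℤ) : ℝ) : ℂ) * (((d.sign : ℤ) : ℝ) : ℂ) = 1 := by
  rcases Int.units_eq_one_or d.sign with h | h <;> simp [h]

/-- The unnormalized eigenvector with a given label: the state of the label, projected first to the
eigenspace of `A a` and then to that of `∑ A k`, for the sign of the label. -/
noncomputable def ladderVector (A : Fin 3 → X →ₗ[ℂ] X) (w : Fin 3 → ℝ)
    (ψ : (Fin 3 → ℕ) → (Fin 3 → Fin 2) → X) : Option CanonLabel → X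
  | none => ψ 0 0
  | some d =>
      signProj (∑ k, A k) (Real.sqrt (levelEnergySq w d.1.level)) ((d.1.sign : ℤ) : ℝ)
        (signProj (A d.1.first) (Real.sqrt (2 * w d.1.first * d.1.level d.1.first))
          ((d.1.sign : ℤ) : ℝ) (ψ d.1.n d.1.δ))

variable {ι : X →ₗ[ℂ] H} {A : Fin 3 → X →ₗ[ℂ] X} {w : Fin 3 → ℝ}
  {ψ : (Fin 3 → ℕ) → (Fin 3 → Fin 2) → X}

theorem levelEnergySq_pos (hw : ∀ a, 0 < w a) {N : Fin 3 → ℕ} (hN : ∃ k, N k ≠ 0) :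
    0 < levelEnergySq w N := by
  obtain ⟨k, hk⟩ := hN
  refine Finset.sum_pos' (fun a _ => ?_) ⟨k, Finset.mem_univ _, ?_⟩
  · have := hw a; positivity
  · have := hw k
    have : (0 : ℝ) < N k := by exact_mod_cast Nat.pos_of_ne_zero hk
    positivity

theorem ofReal_sqrt_mul_self {r : ℝ} (hr : 0 ≤ r) :
    ((Real.sqrt r : ℝ) : ℂ) * ((Real.sqrt r : ℝ) : ℂ) = (r : ℂ) := by
  rw [← Complex.ofReal_mul, Real.mul_self_sqrt hr]

namespace IsLadder

theorem anticomm_sum (h : IsLadder ι A w ψ) (a : Fin 3) (x : X) :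
    A a ((∑ k, A k) x) + (∑ k, A k) (A a x) = (2 : ℂ) • A a (A a x) := by
  rw [LinearMap.sum_apply, LinearMap.sum_apply, map_sum, ← Finset.sum_add_distrib,
    Finset.sum_eq_single a]
  · rw [two_smul]
  · intro b _ hb
    rw [h.anti a b hb.symm, neg_add_cancel]
  · simp

theorem sum_sum_apply (h : IsLadder ι A w ψ) {N : Fin 3 → ℕ} {x : X}
    (hx : x ∈ levelSpace A w N) :
    (∑ k, A k) ((∑ k, A k) x) = (levelEnergySq w N : ℂ) • x := by
  have e01 := h.anti 0 1 (by decide) x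
  have e02 := h.anti 0 2 (by decide) x
  have e12 := h.anti 1 2 (by decide) x
  have h0 := hx 0
  have h1 := hx 1
  have h2 := hx 2
  simp only [levelEnergySq, Fin.sum_univ_three, LinearMap.add_apply, map_add, Complex.ofReal_add,
    add_smul]
  rw [← h0, ← h1, ← h2, e01, e02, e12]
  abel

theorem apply_mem_levelSpace (h : IsLadder ι A w ψ) {N : Fin 3 → ℕ} {x : X}
    (hx : x ∈ levelSpace A w N) (b : Fin 3) : A b x ∈ levelSpace A w N := by
  intro a
  by_cases hab : a = b
  · subst hab
    rw [hx a, map_smul]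
  · rw [h.anti a b hab, map_neg, h.anti a b hab, neg_neg, hx a, map_smul]

theorem sum_mem_levelSpace (h : IsLadder ι A w ψ) {N : Fin 3 → ℕ} {x : X}
    (hx : x ∈ levelSpace A w N) : (∑ k, A k) x ∈ levelSpace A w N := by
  rw [LinearMap.sum_apply]
  exact Submodule.sum_mem _ fun b _ => h.apply_mem_levelSpace hx b

theorem state_mem_levelSpace (h : IsLadder ι A w ψ) (n : Fin 3 → ℕ) (δ : Fin 3 → Fin 2) :
    ψ n δ ∈ levelSpace A w fun k => (δ k + n k : ℕ) := fun a => h.sq a n δ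

theorem signProj_mem_levelSpace (h : IsLadder ι A w ψ) {N : Fin 3 → ℕ} {x : X}
    (hx : x ∈ levelSpace A w N) (a : Fin 3) (e ε : ℂ) :
    signProj (A a) e ε x ∈ levelSpace A w N :=
  Submodule.add_mem _ (Submodule.smul_mem _ _ hx)
    (Submodule.smul_mem _ _ (h.apply_mem_levelSpace hx a))

theorem signProj_sum_mem_levelSpace (h : IsLadder ι A w ψ) {N : Fin 3 → ℕ} {x : X}
    (hx : x ∈ levelSpace A w N) (e ε : ℂ) :
    signProj (∑ k, A k) e ε x ∈ levelSpace A w N :=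
  Submodule.add_mem _ (Submodule.smul_mem _ _ hx)
    (Submodule.smul_mem _ _ (h.sum_mem_levelSpace hx))

theorem sum_sum_apply' (h : IsLadder ι A w ψ) {N : Fin 3 → ℕ} {x : X}
    (hx : x ∈ levelSpace A w N) :
    (∑ k, A k) ((∑ k, A k) x) = ((Real.sqrt (levelEnergySq w N) : ℂ) *
      (Real.sqrt (levelEnergySq w N) : ℂ)) • x := by
  rw [h.sum_sum_apply hx, ofReal_sqrt_mul_self]
  exact Finset.sum_nonneg fun a _ => by have := h.pos a; positivity

theorem apply_apply' (h : IsLadder ι A w ψ) {N : Fin 3 → ℕ} {x : X}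
    (hx : x ∈ levelSpace A w N) (a : Fin 3) :
    A a (A a x) = ((Real.sqrt (2 * w a * N a) : ℂ) * (Real.sqrt (2 * w a * N a) : ℂ)) • x := by
  rw [hx a, ofReal_sqrt_mul_self]
  have := h.pos a; positivity

theorem ladderVector_mem (h : IsLadder ι A w ψ) (d : CanonLabel) :
    ladderVector A w ψ (some d) ∈ levelSpace A w d.1.level :=
  h.signProj_sum_mem_levelSpace (h.signProj_mem_levelSpace (h.state_mem_levelSpace _ _) _ _ _) _ _

theorem sum_ladderVector (h : IsLadder ι A w ψ) (j : Option CanonLabel) :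
    (∑ k, A k) (ladderVector A w ψ j) = (labelEnergy w j : ℂ) • ladderVector A w ψ j := by
  cases j with
  | none =>
    simp only [ladderVector, labelEnergy, LinearMap.sum_apply, Complex.ofReal_zero, zero_smul]
    exact Finset.sum_eq_zero fun a _ => h.vanish a 0 0 (by simp)
  | some d =>
    simp only [ladderVector, labelEnergy, Complex.ofReal_mul]
    exact apply_signProj d.1.sign_mul_self (h.sum_sum_apply'
      (h.signProj_mem_levelSpace (h.state_mem_levelSpace _ _) _ _ _))

/-- The inner product of two eigenvectors with the same sign and levels is a positive multiple of
that of the underlying states. -/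
theorem inner_ladderVector (h : IsLadder ι A w ψ) {d d' : CanonLabel}
    (hs : d.1.sign = d'.1.sign) (hl : d.1.level = d'.1.level) :
    ∃ r : ℝ, 0 < r ∧ inner ℂ (ι (ladderVector A w ψ (some d)))
      (ι (ladderVector A w ψ (some d'))) =
        (r : ℂ) * inner ℂ (ι (ψ d.1.n d.1.δ)) (ι (ψ d'.1.n d'.1.δ)) := by
  have hf : d.1.first = d'.1.first := DataSet.first_congr fun k => congrFun hl k
  have hdδ := d.2
  have hdδ' := d'.2
  simp only [ladderVector]
  rw [← hs, ← hl, ← hf]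
  rw [← hf] at hdδ'
  set a := d.1.first with ha
  have hεε := d.1.sign_mul_self
  set ε : ℝ := ((d.1.sign : ℤ) : ℝ)
  have hEpos : 0 < Real.sqrt (levelEnergySq w d.1.level) :=
    Real.sqrt_pos.2 (levelEnergySq_pos h.pos d.1.exists_level_ne_zero)
  have hepos : 0 < Real.sqrt (2 * w a * d.1.level a) := by
    have h1 := h.pos a
    have h2 : (0 : ℝ) < d.1.level a := by exact_mod_cast Nat.pos_of_ne_zero d.1.level_first_ne_zero
    exact Real.sqrt_pos.2 (by positivity)
  have hx : ψ d'.1.n d'.1.δ ∈ levelSpace A w d.1.level := by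
    rw [hl]; exact h.state_mem_levelSpace _ _
  have hA := h.apply_apply' hx a
  have hqx := h.signProj_mem_levelSpace hx a (Real.sqrt (2 * w a * d.1.level a) : ℂ) (ε : ℂ)
  have hD := h.sum_sum_apply' hqx
  set e : ℝ := Real.sqrt (2 * w a * d.1.level a)
  set E : ℝ := Real.sqrt (levelEnergySq w d.1.level)
  have hflip : inner ℂ (ι (ψ d.1.n d.1.δ)) (ι (A a (ψ d'.1.n d'.1.δ))) = 0 := by
    have hne : (d'.1.δ a + d'.1.n a : ℕ) ≠ 0 := by
      have := d.1.level_first_ne_zero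
      rwa [hl] at this
    obtain ⟨κ, n', δ', hκ, -, hδ', -⟩ := h.flip a _ _ hne
    rw [hκ, map_smul, inner_smul_right, h.orth, mul_zero]
    intro hh
    apply hδ'
    rw [← (Prod.mk.inj hh).2, hdδ, hdδ']
  refine ⟨2 * E * (2 * e * (E + e)) * e, by positivity, ?_⟩
  rw [(SymmetricVia.sum h.symm).signProj, signProj_signProj hεε hD, map_smul, inner_smul_right,
    (h.symm a).signProj, signProj_sandwich hεε hA (h.anticomm_sum a), map_smul, inner_smul_right,
    signProj_apply, map_add, map_smul, map_smul, inner_add_right, inner_smul_right,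
    inner_smul_right, hflip]
  push_cast
  ring

theorem ladderVector_ne_zero (h : IsLadder ι A w ψ) (j : Option CanonLabel) :
    ι (ladderVector A w ψ j) ≠ 0 := by
  cases j with
  | none => exact h.ne_zero 0 0
  | some d =>
    obtain ⟨r, hr, hin⟩ := h.inner_ladderVector (d := d) (d' := d) rfl rfl
    intro h0
    rw [h0, inner_zero_left] at hin
    have h1 : inner ℂ (ι (ψ d.1.n d.1.δ)) (ι (ψ d.1.n d.1.δ)) ≠ 0 :=
      inner_self_ne_zero.2 (h.ne_zero _ _)
    exact mul_ne_zero (Complex.ofReal_ne_zero.2 hr.ne') h1 hin.symm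

theorem labelEnergy_some_ne_zero (h : IsLadder ι A w ψ) (d : CanonLabel) :
    labelEnergy w (some d) ≠ 0 := by
  have h1 : 0 < Real.sqrt (levelEnergySq w d.1.level) :=
    Real.sqrt_pos.2 (levelEnergySq_pos h.pos d.1.exists_level_ne_zero)
  refine mul_ne_zero ?_ h1.ne'
  rcases Int.units_eq_one_or d.1.sign with hs | hs <;> simp [hs]

theorem ladderVector_orthogonal (h : IsLadder ι A w ψ) {j j' : Option CanonLabel} (hne : j ≠ j') :
    inner ℂ (ι (ladderVector A w ψ j)) (ι (ladderVector A w ψ j')) = 0 := by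
  have hD : SymmetricVia ι (∑ k, A k) := SymmetricVia.sum h.symm
  by_cases hE : labelEnergy w j = labelEnergy w j'
  swap
  · exact hD.inner_eq_zero (h.sum_ladderVector j) (h.sum_ladderVector j') hE
  match j, j', hne, hE with
  | none, none, hne, _ => exact absurd rfl hne
  | none, some d, _, hE => exact absurd hE.symm (h.labelEnergy_some_ne_zero d)
  | some d, none, _, hE => exact absurd hE (h.labelEnergy_some_ne_zero d)
  | some d, some d', hne, hE =>
    by_cases hl : d.1.level = d'.1.level
    · have hs : d.1.sign = d'.1.sign := by
        have h1 : 0 < Real.sqrt (levelEnergySq w d'.1.level) :=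
          Real.sqrt_pos.2 (levelEnergySq_pos h.pos d'.1.exists_level_ne_zero)
        simp only [labelEnergy, hl] at hE
        have := mul_right_cancel₀ h1.ne' hE
        exact Units.ext (by exact_mod_cast this)
      obtain ⟨r, -, hr⟩ := h.inner_ladderVector hs hl
      rw [hr, h.orth, mul_zero]
      intro hh
      obtain ⟨hn, hδ⟩ := Prod.mk.inj hh
      exact hne (congrArg some (Subtype.ext (DataSet.ext' hs hδ hn)))
    · obtain ⟨k, hk⟩ := Function.ne_iff.1 hl
      refine (h.symm k).comp_self.inner_eq_zero (h.ladderVector_mem d k) (h.ladderVector_mem d' k) ?_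
      have := h.pos k
      intro hh
      exact hk (by exact_mod_cast mul_left_cancel₀ (by positivity) hh)

/-- The projections of any state of nonzero levels lie in the span of the eigenvectors: at the first
nonvanishing index the state with `δ = 1` and its partner with `δ = 0` have proportional
projections. -/
theorem projection_state_mem_span (h : IsLadder ι A w ψ) {N : Fin 3 → ℕ} (hN : ∃ k, N k ≠ 0)
    (s : ℤˣ) (n : Fin 3 → ℕ) (δ : Fin 3 → Fin 2) (hnδ : ∀ k, (δ k + n k : ℕ) = N k) :
    signProj (∑ k, A k) (Real.sqrt (levelEnergySq w N)) (((s : ℤ) : ℝ) : ℂ)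
      (signProj (A (firstIndex N hN))
        (Real.sqrt (2 * w (firstIndex N hN) * N (firstIndex N hN))) (((s : ℤ) : ℝ) : ℂ) (ψ n δ)) ∈
      Submodule.span ℂ (Set.range (ladderVector A w ψ)) := by
  set a := firstIndex N hN with ha
  have canonical : ∀ (n : Fin 3 → ℕ) (δ : Fin 3 → Fin 2), (∀ k, (δ k + n k : ℕ) = N k) →
      δ a = 0 → signProj (∑ k, A k) (Real.sqrt (levelEnergySq w N)) (((s : ℤ) : ℝ) : ℂ)
      (signProj (A a) (Real.sqrt (2 * w a * N a)) (((s : ℤ) : ℝ) : ℂ) (ψ n δ)) ∈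
      Submodule.span ℂ (Set.range (ladderVector A w ψ)) := by
    intro n δ hnδ hδ
    obtain ⟨k, hk⟩ := hN
    let d : DataSet := ⟨s, δ, n, fun hh => hk (by rw [← hnδ k, (hh k).1, (hh k).2]; rfl)⟩
    have hlev : d.level = N := funext hnδ
    have hfirst : d.first = a := by
      unfold DataSet.first
      simp only [hlev, ha]
    refine Submodule.subset_span ⟨some ⟨d, by rw [hfirst]; exact hδ⟩, ?_⟩
    simp only [ladderVector, hlev, hfirst, d]
  by_cases hδ : δ a = 0
  · exact canonical n δ hnδ hδ
  · -- With `δ a = 1`, the vector `A a (ψ n δ)` is a multiple of a state with `δ a = 0`.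
    have hNa : N a ≠ 0 := firstIndex_ne_zero N hN
    obtain ⟨κ, n', δ', hκ, hlev, hδ', -⟩ := h.flip a n δ (by rw [hnδ]; exact hNa)
    have hc := canonical n' δ' (fun k => by rw [hlev, hnδ]) (by
      have h1 := Fin.val_ne_of_ne hδ'
      have h2 := Fin.val_ne_of_ne hδ
      apply Fin.ext
      simp only [Fin.val_zero] at h2 ⊢
      omega)
    have hx : ψ n δ ∈ levelSpace A w N := by
      have := h.state_mem_levelSpace n δ
      rwa [show (fun k => (δ k + n k : ℕ)) = N from funext hnδ] at this
    have hεε : (((s : ℤ) : ℝ) : ℂ) * (((s : ℤ) : ℝ) : ℂ) = 1 := by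
      rcases Int.units_eq_one_or s with hs | hs <;> simp [hs]
    have hproj := signProj_apply_apply hεε (h.apply_apply' hx a)
    rw [hκ, map_smul] at hproj
    have hne : (((s : ℤ) : ℝ) : ℂ) * (Real.sqrt (2 * w a * N a) : ℂ) ≠ 0 := by
      refine mul_ne_zero (left_ne_zero_of_mul (hεε ▸ one_ne_zero)) ?_
      have h1 := h.pos a
      have h2 : (0 : ℝ) < N a := by exact_mod_cast Nat.pos_of_ne_zero hNa
      exact Complex.ofReal_ne_zero.2 (Real.sqrt_pos.2 (by positivity)).ne'
    rw [← inv_smul_smul₀ hne (signProj (A a) _ _ (ψ n δ)), ← hproj, map_smul, map_smul]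
    exact Submodule.smul_mem _ _ (Submodule.smul_mem _ _ hc)

/-- Every state is a combination of the eigenvectors. Both sign projections `P_D` of the state are
recovered from `P_D P_A P_D`, where `P_D` keeps the span of the states with given levels. -/
theorem state_mem_span_ladderVector (h : IsLadder ι A w ψ) (n : Fin 3 → ℕ) (δ : Fin 3 → Fin 2) :
    ψ n δ ∈ Submodule.span ℂ (Set.range (ladderVector A w ψ)) := by
  set N : Fin 3 → ℕ := fun k => (δ k + n k : ℕ) with hNdef
  by_cases hN : ∃ k, N k ≠ 0
  swap
  · push Not at hN
    have hn : n = 0 := funext fun k => by have := hN k; simp only [hNdef] at this; simp; omega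
    have hδ : δ = 0 := funext fun k => by
      have := hN k; simp only [hNdef] at this; exact Fin.ext (by simp; omega)
    rw [hn, hδ]
    exact Submodule.subset_span ⟨none, rfl⟩
  set W : Submodule ℂ X := Submodule.span ℂ
    {x | ∃ n' δ', (∀ k, (δ' k + n' k : ℕ) = N k) ∧ x = ψ n' δ'} with hW
  have hxW : ψ n δ ∈ W := Submodule.subset_span ⟨n, δ, fun _ => rfl, rfl⟩
  have hDW : (∑ k, A k) (ψ n δ) ∈ W := by
    rw [LinearMap.sum_apply]
    refine Submodule.sum_mem _ fun b _ => ?_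
    by_cases hb : (δ b + n b : ℕ) = 0
    · rw [h.vanish b n δ hb]; exact Submodule.zero_mem _
    · obtain ⟨κ, n', δ', hκ, hlev, -, -⟩ := h.flip b n δ hb
      rw [hκ]
      exact Submodule.smul_mem _ _ (Submodule.subset_span ⟨n', δ', hlev, rfl⟩)
  have hPW : ∀ (s : ℤˣ), ∀ x ∈ W,
      signProj (∑ k, A k) (Real.sqrt (levelEnergySq w N)) (((s : ℤ) : ℝ) : ℂ)
      (signProj (A (firstIndex N hN))
        (Real.sqrt (2 * w (firstIndex N hN) * N (firstIndex N hN))) (((s : ℤ) : ℝ) : ℂ) x) ∈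
      Submodule.span ℂ (Set.range (ladderVector A w ψ)) := by
    intro s x hx
    induction hx using Submodule.span_induction with
    | mem x hx =>
      obtain ⟨n', δ', hlev, rfl⟩ := hx
      exact h.projection_state_mem_span hN s n' δ' hlev
    | zero => simp
    | add x y _ _ hx hy => simp only [map_add]; exact Submodule.add_mem _ hx hy
    | smul c x _ hx => simp only [map_smul]; exact Submodule.smul_mem _ _ hx
  have hxL : ψ n δ ∈ levelSpace A w N := h.state_mem_levelSpace n δ
  set a := firstIndex N hN with ha
  have hEpos : 0 < Real.sqrt (levelEnergySq w N) := Real.sqrt_pos.2 (levelEnergySq_pos h.pos hN)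
  have hepos : 0 < Real.sqrt (2 * w a * N a) := by
    have h1 := h.pos a
    have h2 : (0 : ℝ) < N a := by exact_mod_cast Nat.pos_of_ne_zero (firstIndex_ne_zero N hN)
    exact Real.sqrt_pos.2 (by positivity)
  have hP : ∀ s : ℤˣ, signProj (∑ k, A k) (Real.sqrt (levelEnergySq w N)) (((s : ℤ) : ℝ) : ℂ)
      (ψ n δ) ∈ Submodule.span ℂ (Set.range (ladderVector A w ψ)) := by
    intro s
    have hεε : (((s : ℤ) : ℝ) : ℂ) * (((s : ℤ) : ℝ) : ℂ) = 1 := by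
      rcases Int.units_eq_one_or s with hs | hs <;> simp [hs]
    have hmem := hPW s _ (Submodule.add_mem W
      (Submodule.smul_mem W (Real.sqrt (levelEnergySq w N) : ℂ) hxW)
      (Submodule.smul_mem W (((s : ℤ) : ℝ) : ℂ) hDW))
    rw [← signProj_apply, signProj_sandwich' hεε (h.apply_apply' hxL a) (h.sum_sum_apply' hxL)
      (h.anticomm_sum a) (h.sum_sum_apply' (h.apply_mem_levelSpace hxL a))] at hmem
    refine (Submodule.smul_mem_iff _ ?_).1 hmem
    rw [show (2 : ℂ) * (Real.sqrt (2 * w a * N a) : ℂ) * ((Real.sqrt (levelEnergySq w N) : ℂ) +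
      (Real.sqrt (2 * w a * N a) : ℂ)) = ((2 * Real.sqrt (2 * w a * N a) *
        (Real.sqrt (levelEnergySq w N) + Real.sqrt (2 * w a * N a)) : ℝ) : ℂ) by push_cast; ring]
    exact Complex.ofReal_ne_zero.2 (by positivity)
  have hsum := Submodule.add_mem _ (hP 1) (hP (-1))
  have hsum' : signProj (∑ k, A k) (Real.sqrt (levelEnergySq w N)) ((((1 : ℤˣ) : ℤ) : ℝ) : ℂ)
      (ψ n δ) + signProj (∑ k, A k) (Real.sqrt (levelEnergySq w N))
        ((((-1 : ℤˣ) : ℤ) : ℝ) : ℂ) (ψ n δ) =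
      (2 * (Real.sqrt (levelEnergySq w N) : ℂ)) • ψ n δ := by
    simp only [signProj_apply, Units.val_one, Units.val_neg, Int.cast_one, Int.cast_neg,
      Complex.ofReal_one, Complex.ofReal_neg]
    module
  rw [hsum'] at hsum
  exact (Submodule.smul_mem_iff _ (mul_ne_zero two_ne_zero
    (Complex.ofReal_ne_zero.2 hEpos.ne'))).1 hsum

/-- The normalized eigenvectors of `∑ A k` form a Hilbert basis labelled by the classes of labels,
with one additional vector in the kernel. -/
theorem exists_eigenbasis [CompleteSpace H] (h : IsLadder ι A w ψ) :
    ∃ (x : Option CanonLabel → X) (b : HilbertBasis (Option CanonLabel) ℂ H),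
      (∀ j, b j = ι (x j)) ∧ ∀ j, (∑ k, A k) (x j) = (labelEnergy w j : ℂ) • x j := by
  set x : Option CanonLabel → X := fun j =>
    ((‖ι (ladderVector A w ψ j)‖⁻¹ : ℝ) : ℂ) • ladderVector A w ψ j with hx
  have hne : ∀ j, ‖ι (ladderVector A w ψ j)‖ ≠ 0 := fun j =>
    norm_ne_zero_iff.2 (h.ladderVector_ne_zero j)
  have ho : Orthonormal ℂ fun j => ι (x j) := by
    refine ⟨fun j => ?_, fun j j' hjj => ?_⟩
    · simp only [hx, map_smul, norm_smul, Complex.norm_real, norm_inv, norm_norm]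
      exact inv_mul_cancel₀ (hne j)
    · simp only [hx, map_smul, inner_smul_left, inner_smul_right, h.ladderVector_orthogonal hjj,
        mul_zero]
  have hspan : ⊤ ≤ (Submodule.span ℂ (Set.range fun j => ι (x j))).topologicalClosure := by
    rw [← h.total]
    refine Submodule.topologicalClosure_mono (Submodule.span_le.2 ?_)
    rintro _ ⟨⟨n, δ⟩, rfl⟩
    have h1 := Submodule.mem_map_of_mem (f := ι) (h.state_mem_span_ladderVector n δ)
    rw [Submodule.map_span] at h1
    refine (Submodule.span_le.2 ?_) h1
    rintro _ ⟨_, ⟨j, rfl⟩, rfl⟩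
    have h2 : ι (ladderVector A w ψ j) = (‖ι (ladderVector A w ψ j)‖ : ℂ) • ι (x j) := by
      simp only [hx, map_smul, smul_smul]
      rw [← Complex.ofReal_mul, mul_inv_cancel₀ (hne j), Complex.ofReal_one, one_smul]
    rw [h2]
    exact Submodule.smul_mem _ _ (Submodule.subset_span ⟨j, rfl⟩)
  refine ⟨x, HilbertBasis.mk ho hspan, fun j => by rw [HilbertBasis.coe_mk], fun j => ?_⟩
  simp only [hx, map_smul, h.sum_ladderVector j]
  rw [smul_comm]

end IsLadder

/-- The energies tend to infinity, with finite multiplicities. -/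
theorem finite_labelEnergy_le (hw : ∀ a, 0 < w a) (C : ℝ) :
    {j : Option CanonLabel | |labelEnergy w j| ≤ C}.Finite := by
  -- Bounded energy bounds every level, and a label is determined by its sign, `δ` and levels.
  have hb : ∃ B : ℕ, ∀ k, C ^ 2 ≤ 2 * w k * B := by
    have : ∀ k, ∃ B : ℕ, C ^ 2 ≤ 2 * w k * B := fun k => by
      obtain ⟨B, hB⟩ := exists_nat_ge (C ^ 2 / (2 * w k))
      refine ⟨B, ?_⟩
      have := hw k
      rw [div_le_iff₀ (by positivity)] at hB
      linarith
    choose B hB using this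
    refine ⟨∑ k, B k, fun k => (hB k).trans ?_⟩
    have h1 : B k ≤ ∑ k, B k := Finset.single_le_sum (fun _ _ => Nat.zero_le _) (Finset.mem_univ k)
    have h2 : (B k : ℝ) ≤ (∑ k, B k : ℕ) := by exact_mod_cast h1
    have := hw k
    gcongr
  obtain ⟨B, hB⟩ := hb
  let f : CanonLabel → ℤˣ × (Fin 3 → Fin 2) × (Fin 3 → ℕ) := fun d => (d.1.sign, d.1.δ, d.1.n)
  have hf : Function.Injective f := fun d d' hdd => by
    simp only [f, Prod.mk.injEq] at hdd
    exact Subtype.ext (DataSet.ext' hdd.1 hdd.2.1 hdd.2.2)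
  have hfin : {d : CanonLabel | |labelEnergy w (some d)| ≤ C}.Finite := by
    refine Set.Finite.of_finite_image (f := f) (Set.Finite.subset
      (Set.finite_univ.prod (Set.finite_univ.prod (Set.finite_Iic fun _ => B))) ?_) hf.injOn
    rintro _ ⟨d, hd, rfl⟩
    refine ⟨Set.mem_univ _, Set.mem_univ _, fun k => ?_⟩
    have hd' : |labelEnergy w (some d)| ≤ C := hd
    have hsgn : |((d.1.sign : ℤ) : ℝ)| = 1 := by
      rcases Int.units_eq_one_or d.1.sign with hs | hs <;> simp [hs]
    rw [labelEnergy, abs_mul, hsgn, one_mul, abs_of_nonneg (Real.sqrt_nonneg _)] at hd'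
    have h0 : 0 ≤ levelEnergySq w d.1.level :=
      Finset.sum_nonneg fun a _ => by have := hw a; positivity
    have h1 : levelEnergySq w d.1.level ≤ C ^ 2 := by
      rw [← Real.sq_sqrt h0]
      exact pow_le_pow_left₀ (Real.sqrt_nonneg _) hd' 2
    have h2 : 2 * w k * d.1.level k ≤ levelEnergySq w d.1.level :=
      Finset.single_le_sum (f := fun k => 2 * w k * (d.1.level k : ℝ))
        (fun a _ => by have := hw a; positivity) (Finset.mem_univ k)
    have h3 : (d.1.level k : ℝ) ≤ B := by
      have := hw k
      refine le_of_mul_le_mul_left ((h2.trans h1).trans (hB k)) (by positivity)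
    have h4 : d.1.level k ≤ B := by exact_mod_cast h3
    unfold DataSet.level at h4
    show d.1.n k ≤ B
    omega
  refine ((hfin.image some).insert none).subset ?_
  rintro (_ | d) hd
  · exact Set.mem_insert _ _
  · exact Set.mem_insert_of_mem _ ⟨d, hd, rfl⟩

end Ladder

/-! ### Spinors of a Clifford system -/

section Spinors

theorem matC_mul (A B : Matrix (Fin 8) (Fin 8) ℝ) (x : C8) :
    matC (A * B) x = matC A (matC B x) := by
  have : (A * B).map (fun r : ℝ => (r : ℂ)) =
      A.map (fun r : ℝ => (r : ℂ)) * B.map (fun r : ℝ => (r : ℂ)) :=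
    Matrix.map_mul (f := Complex.ofRealHom)
  unfold matC
  rw [this, map_mul]; rfl

theorem matC_add (A B : Matrix (Fin 8) (Fin 8) ℝ) : matC (A + B) = matC A + matC B := by
  unfold matC
  rw [← map_add]; congr 1; ext i j; simp

theorem matC_smul (r : ℝ) (A : Matrix (Fin 8) (Fin 8) ℝ) : matC (r • A) = (r : ℂ) • matC A := by
  unfold matC
  rw [← map_smul]; congr 1; ext i j; simp

theorem matC_neg (A : Matrix (Fin 8) (Fin 8) ℝ) : matC (-A) = -matC A := by
  unfold matC
  rw [← map_neg]; congr 1; ext i j; simp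

theorem matC_one : matC 1 = ContinuousLinearMap.id ℂ C8 := by
  unfold matC
  rw [Matrix.map_one _ (by simp) (by simp), map_one]; rfl

theorem matC_zero : matC 0 = 0 := by
  unfold matC
  rw [Matrix.map_zero _ (by simp), map_zero]

theorem matC_sum {κ : Type*} (s : Finset κ) (A : κ → Matrix (Fin 8) (Fin 8) ℝ) :
    matC (∑ k ∈ s, A k) = ∑ k ∈ s, matC (A k) := by
  classical
  induction s using Finset.induction_on with
  | empty => simp [matC_zero]
  | insert a s ha ih => rw [Finset.sum_insert ha, Finset.sum_insert ha, matC_add, ih]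

theorem inner_matC_left (A : Matrix (Fin 8) (Fin 8) ℝ) (x y : C8) :
    inner ℂ (matC A x) y = inner ℂ x (matC A.transpose y) := by
  have : matC A.transpose = ContinuousLinearMap.adjoint (matC A) := by
    unfold matC
    rw [← ContinuousLinearMap.star_eq_adjoint, ← map_star]
    congr 1
    ext i j
    simp [Matrix.star_apply]
  rw [this, ContinuousLinearMap.adjoint_inner_right]

variable {γ : Fin 3 → Matrix (Fin 8) (Fin 8) ℝ} {γs : Matrix (Fin 8) (Fin 8) ℝ}
  {ρ : Fin 3 → Matrix (Fin 8) (Fin 8) ℝ}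

/-- The Hermitian involution `i γ_a ρ_a` on spinors. -/
noncomputable def chirality (γ ρ : Fin 3 → Matrix (Fin 8) (Fin 8) ℝ) (a : Fin 3) : C8 →L[ℂ] C8 :=
  Complex.I • (matC (γ a) ∘L matC (ρ a))

theorem chirality_apply (a : Fin 3) (x : C8) :
    chirality γ ρ a x = Complex.I • matC (γ a) (matC (ρ a) x) := rfl

namespace IsCliffordSystem

theorem γ_sq (h : IsCliffordSystem γ γs ρ) (a : Fin 3) (x : C8) :
    matC (γ a) (matC (γ a) x) = -x := by
  have h1 : γ a * γ a = -1 := by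
    have := h.γ_γ a a
    rw [if_pos rfl, ← two_smul ℝ, show (-2 : ℝ) • (1 : Matrix (Fin 8) (Fin 8) ℝ) =
      (2 : ℝ) • (-1) by module] at this
    exact smul_right_injective _ (two_ne_zero) this
  rw [← matC_mul, h1, matC_neg, matC_one]; rfl

theorem ρ_sq (h : IsCliffordSystem γ γs ρ) (a : Fin 3) (x : C8) :
    matC (ρ a) (matC (ρ a) x) = -x := by
  have h1 : ρ a * ρ a = -1 := by
    have := h.ρ_ρ a a
    rw [if_pos rfl, ← two_smul ℝ, show (-2 : ℝ) • (1 : Matrix (Fin 8) (Fin 8) ℝ) =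
      (2 : ℝ) • (-1) by module] at this
    exact smul_right_injective _ (two_ne_zero) this
  rw [← matC_mul, h1, matC_neg, matC_one]; rfl

theorem matC_anticomm {A B : Matrix (Fin 8) (Fin 8) ℝ} (h : A * B + B * A = 0) (x : C8) :
    matC A (matC B x) = -matC B (matC A x) := by
  rw [← matC_mul, ← matC_mul, eq_neg_of_add_eq_zero_left h, matC_neg]; rfl

theorem γ_anticomm (h : IsCliffordSystem γ γs ρ) {a b : Fin 3} (hab : a ≠ b) (x : C8) :
    matC (γ a) (matC (γ b) x) = -matC (γ b) (matC (γ a) x) :=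
  matC_anticomm (by rw [h.γ_γ, if_neg hab]) x

theorem ρ_anticomm (h : IsCliffordSystem γ γs ρ) {a b : Fin 3} (hab : a ≠ b) (x : C8) :
    matC (ρ a) (matC (ρ b) x) = -matC (ρ b) (matC (ρ a) x) :=
  matC_anticomm (by rw [h.ρ_ρ, if_neg hab]) x

theorem ργ_anticomm (h : IsCliffordSystem γ γs ρ) (a b : Fin 3) (x : C8) :
    matC (ρ a) (matC (γ b) x) = -matC (γ b) (matC (ρ a) x) :=
  matC_anticomm (h.ρ_γ a b) x

theorem chirality_γ_self (h : IsCliffordSystem γ γs ρ) (a : Fin 3) (x : C8) :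
    chirality γ ρ a (matC (γ a) x) = -matC (γ a) (chirality γ ρ a x) := by
  simp only [chirality_apply, map_smul, h.ργ_anticomm a a, map_neg, smul_neg]

theorem chirality_γ (h : IsCliffordSystem γ γs ρ) {a b : Fin 3} (hab : a ≠ b) (x : C8) :
    chirality γ ρ a (matC (γ b) x) = matC (γ b) (chirality γ ρ a x) := by
  simp only [chirality_apply, map_smul, h.ργ_anticomm a b, map_neg,
    h.γ_anticomm hab, neg_neg]

theorem chirality_comm (h : IsCliffordSystem γ γs ρ) {a b : Fin 3} (hab : a ≠ b) (x : C8) :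
    chirality γ ρ a (chirality γ ρ b x) = chirality γ ρ b (chirality γ ρ a x) := by
  simp only [chirality_apply, map_smul, h.ργ_anticomm a b, h.ργ_anticomm b a, map_neg, smul_neg,
    h.γ_anticomm hab, h.ρ_anticomm hab, neg_neg]

theorem chirality_chirality (h : IsCliffordSystem γ γs ρ) (a : Fin 3) (x : C8) :
    chirality γ ρ a (chirality γ ρ a x) = x := by
  simp only [chirality_apply, map_smul, h.ργ_anticomm a a, map_neg, smul_neg, h.γ_sq, h.ρ_sq,
    neg_neg, smul_smul, Complex.I_mul_I, neg_smul, one_smul]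

/-- `i ρ_a = -γ_a σ_a` for the chirality `σ_a = i γ_a ρ_a`. -/
theorem I_smul_ρ (h : IsCliffordSystem γ γs ρ) (a : Fin 3) (x : C8) :
    Complex.I • matC (ρ a) x = -matC (γ a) (chirality γ ρ a x) := by
  simp only [chirality_apply, map_smul, h.γ_sq, smul_neg, neg_neg]

theorem chirality_symm (h : IsCliffordSystem γ γs ρ) (a : Fin 3) (x y : C8) :
    inner ℂ (chirality γ ρ a x) y = inner ℂ x (chirality γ ρ a y) := by
  simp only [chirality_apply, inner_smul_left, inner_smul_right, inner_matC_left, h.γ_antisymm,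
    h.ρ_antisymm, matC_neg, _root_.neg_apply, h.ργ_anticomm, inner_neg_right, neg_neg,
    Complex.conj_I, neg_mul, mul_neg]

/-- A joint eigenvector for the eigenvalue `-1` of all chiralities. If `x - σ_a x` vanishes then
`σ_a x = x`, and `γ_a x` takes its place. -/
theorem exists_vacuumSpinor (h : IsCliffordSystem γ γs ρ) :
    ∃ x : C8, x ≠ 0 ∧ ∀ a, chirality γ ρ a x = -x := by
  have key : ∀ T : Finset (Fin 3), ∃ x : C8, x ≠ 0 ∧ ∀ a ∈ T, chirality γ ρ a x = -x := by
    intro T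
    induction T using Finset.induction_on with
    | empty =>
      obtain ⟨x, hx⟩ := exists_ne (0 : C8)
      exact ⟨x, hx, by simp⟩
    | insert a T ha ih =>
      obtain ⟨x, hx, hT⟩ := ih
      have hne : ∀ b ∈ T, b ≠ a := fun b hb hba => ha (hba ▸ hb)
      by_cases h0 : x - chirality γ ρ a x = 0
      · refine ⟨matC (γ a) x, fun hγ => hx ?_, fun b hb => ?_⟩
        · have := h.γ_sq a x
          rw [hγ, map_zero] at this
          exact neg_eq_zero.1 this.symm
        · rcases Finset.mem_insert.1 hb with rfl | hb
          · rw [h.chirality_γ_self, ← sub_eq_zero.1 h0]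
          · rw [h.chirality_γ (hne b hb), hT b hb, map_neg]
      · refine ⟨_, h0, fun b hb => ?_⟩
        rcases Finset.mem_insert.1 hb with rfl | hb
        · rw [map_sub, h.chirality_chirality]; abel
        · rw [map_sub, h.chirality_comm (hne b hb), hT b hb, map_neg]; abel
  obtain ⟨x, hx, hT⟩ := key Finset.univ
  exact ⟨x, hx, fun a => hT a (Finset.mem_univ a)⟩

/-- The spinor without any excitation: a joint `-1` eigenvector of the chiralities. -/
noncomputable def vacuumSpinor (h : IsCliffordSystem γ γs ρ) : C8 := h.exists_vacuumSpinor.choose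

/-- The spinor `γ_0 ^ δ_0 γ_1 ^ δ_1 γ_2 ^ δ_2 s` with `s` the vacuum spinor. -/
noncomputable def spinor (h : IsCliffordSystem γ γs ρ) (δ : Fin 3 → Fin 2) : C8 :=
  (if δ 0 = 0 then ContinuousLinearMap.id ℂ C8 else matC (γ 0))
    ((if δ 1 = 0 then ContinuousLinearMap.id ℂ C8 else matC (γ 1))
      ((if δ 2 = 0 then ContinuousLinearMap.id ℂ C8 else matC (γ 2)) h.vacuumSpinor))

theorem chirality_spinor (h : IsCliffordSystem γ γs ρ) (δ : Fin 3 → Fin 2) (a : Fin 3) :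
    chirality γ ρ a (h.spinor δ) = (if δ a = 0 then (-1 : ℂ) else 1) • h.spinor δ := by
  have hv := h.exists_vacuumSpinor.choose_spec.2
  change ∀ a, chirality γ ρ a h.vacuumSpinor = -h.vacuumSpinor at hv
  have s0 := h.chirality_γ_self 0
  have s1 := h.chirality_γ_self 1
  have s2 := h.chirality_γ_self 2
  have c01 := h.chirality_γ (a := 0) (b := 1) (by decide)
  have c02 := h.chirality_γ (a := 0) (b := 2) (by decide)
  have c10 := h.chirality_γ (a := 1) (b := 0) (by decide)
  have c12 := h.chirality_γ (a := 1) (b := 2) (by decide)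
  have c20 := h.chirality_γ (a := 2) (b := 0) (by decide)
  have c21 := h.chirality_γ (a := 2) (b := 1) (by decide)
  unfold spinor
  fin_cases a <;> simp only [Fin.zero_eta, Fin.mk_one, Fin.reduceFinMk] <;> split_ifs <;>
    simp [s0, s1, s2, c01, c02, c10, c12, c20, c21, hv]

/-- Up to a sign, `γ_a` flips `δ_a`. -/
theorem γ_spinor (h : IsCliffordSystem γ γs ρ) (δ : Fin 3 → Fin 2) (a : Fin 3) :
    ∃ κ : ℂ, matC (γ a) (h.spinor δ) = κ • h.spinor (Function.update δ a (1 - δ a)) := by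
  have a10 := h.γ_anticomm (a := 1) (b := 0) (by decide)
  have a20 := h.γ_anticomm (a := 2) (b := 0) (by decide)
  have a21 := h.γ_anticomm (a := 2) (b := 1) (by decide)
  have fin2 : ∀ i : Fin 2, i = 0 ∨ i = 1 := by decide
  by_cases hpos : matC (γ a) (h.spinor δ) = h.spinor (Function.update δ a (1 - δ a))
  · exact ⟨1, by rw [hpos, one_smul]⟩
  · refine ⟨-1, ?_⟩
    revert hpos
    unfold spinor
    rcases fin2 (δ 0) with h0 | h0 <;> rcases fin2 (δ 1) with h1 | h1 <;>
      rcases fin2 (δ 2) with h2 | h2 <;> fin_cases a <;>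
      simp [h0, h1, h2, Function.update, a10, a20, a21, h.γ_sq]

theorem spinor_ne_zero (h : IsCliffordSystem γ γs ρ) (δ : Fin 3 → Fin 2) : h.spinor δ ≠ 0 := by
  have hinj : ∀ a (x : C8), x ≠ 0 → (if δ a = 0 then ContinuousLinearMap.id ℂ C8
      else matC (γ a)) x ≠ 0 := by
    intro a x hx
    split_ifs
    · exact hx
    · intro h0
      have := h.γ_sq a x
      rw [h0, map_zero] at this
      exact hx (neg_eq_zero.1 this.symm)
  exact hinj 0 _ (hinj 1 _ (hinj 2 _ h.exists_vacuumSpinor.choose_spec.1))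

theorem inner_spinor (h : IsCliffordSystem γ γs ρ) {δ δ' : Fin 3 → Fin 2} (hne : δ ≠ δ') :
    inner ℂ (h.spinor δ) (h.spinor δ') = 0 := by
  obtain ⟨a, ha⟩ := Function.ne_iff.1 hne
  have h1 := h.chirality_symm a (h.spinor δ) (h.spinor δ')
  rw [h.chirality_spinor, h.chirality_spinor, inner_smul_left, inner_smul_right] at h1
  have fin2 : ∀ i : Fin 2, i = 0 ∨ i = 1 := by decide
  rcases fin2 (δ a) with h0 | h0 <;> rcases fin2 (δ' a) with h0' | h0'
  · exact absurd (h0.trans h0'.symm) ha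
  · simp only [h0, h0'] at h1
    norm_num at h1
    exact self_eq_neg.1 h1.symm
  · simp only [h0, h0'] at h1
    norm_num at h1
    exact self_eq_neg.1 h1
  · exact absurd (h0.trans h0'.symm) ha

/-- The eight spinors are orthogonal and nonzero, so they span `ℂ⁸`. -/
theorem span_spinor (h : IsCliffordSystem γ γs ρ) :
    Submodule.span ℂ (Set.range h.spinor) = ⊤ := by
  have hli : LinearIndependent ℂ h.spinor :=
    linearIndependent_of_ne_zero_of_inner_eq_zero h.spinor_ne_zero fun _ _ hij => h.inner_spinor hij
  exact hli.span_eq_top_of_card_eq_finrank (by simp)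

end IsCliffordSystem

end Spinors

/-! ### Operators on Schwartz spinors -/

section Schwartz

open scoped SchwartzMap LineDeriv

/-- Schwartz functions `ℝ³ → ℂ⁸`. -/
abbrev SchwartzSpinor : Type := 𝓢(E3, C8)

/-- The derivative in the direction `v` on Schwartz spinors. -/
noncomputable def dirDeriv (v : E3) : SchwartzSpinor →ₗ[ℂ] SchwartzSpinor :=
  (LineDeriv.lineDerivOpCLM ℂ SchwartzSpinor v).toLinearMap

/-- Multiplication by the linear function `⟪u, x⟫` on Schwartz spinors. -/
noncomputable def coordMul (u : E3) : SchwartzSpinor →ₗ[ℂ] SchwartzSpinor :=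
  (SchwartzMap.smulLeftCLM C8 (fun x : E3 => ((inner ℝ u x : ℝ) : ℂ))).toLinearMap

/-- The pointwise action of a real matrix on Schwartz spinors. -/
noncomputable def matS (B : Matrix (Fin 8) (Fin 8) ℝ) : SchwartzSpinor →ₗ[ℂ] SchwartzSpinor :=
  (SchwartzMap.postcompCLM (matC B)).toLinearMap

/-- The inclusion of Schwartz spinors in `L²`. -/
noncomputable def schwartzIncl : SchwartzSpinor →ₗ[ℂ] HilbL :=
  (SchwartzMap.toLpCLM ℂ C8 2 (volume : Measure E3)).toLinearMap

theorem dirDeriv_apply (v : E3) (f : SchwartzSpinor) (x : E3) :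
    dirDeriv v f x = fderiv ℝ f x v := rfl

theorem coordMul_apply (u : E3) (f : SchwartzSpinor) (x : E3) :
    coordMul u f x = ((inner ℝ u x : ℝ) : ℂ) • f x := by
  have h : Function.HasTemperateGrowth (fun x : E3 => ((inner ℝ u x : ℝ) : ℂ)) := by
    have := (Complex.ofRealCLM ∘L innerSL ℝ u).hasTemperateGrowth
    exact this
  exact SchwartzMap.smulLeftCLM_apply_apply h f x

theorem matS_apply (B : Matrix (Fin 8) (Fin 8) ℝ) (f : SchwartzSpinor) (x : E3) :
    matS B f x = matC B (f x) := rfl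

theorem inner_schwartzIncl (f g : SchwartzSpinor) :
    inner ℂ (schwartzIncl f) (schwartzIncl g) = ∫ x, inner ℂ (f x) (g x) :=
  SchwartzMap.inner_toL2_toL2_eq f g

theorem schwartzIncl_injective : Function.Injective schwartzIncl :=
  SchwartzMap.injective_toLp 2 (volume : Measure E3)

theorem matS_dirDeriv (B : Matrix (Fin 8) (Fin 8) ℝ) (v : E3) (f : SchwartzSpinor) :
    matS B (dirDeriv v f) = dirDeriv v (matS B f) := by
  ext1 x
  rw [matS_apply, dirDeriv_apply, dirDeriv_apply]
  have h := ((matC B).restrictScalars ℝ).hasFDerivAt.comp x f.differentiableAt.hasFDerivAt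
  have h' : HasFDerivAt (matS B f) (((matC B).restrictScalars ℝ) ∘L fderiv ℝ f x) x := h
  rw [h'.fderiv]; rfl

theorem matS_coordMul (B : Matrix (Fin 8) (Fin 8) ℝ) (u : E3) (f : SchwartzSpinor) :
    matS B (coordMul u f) = coordMul u (matS B f) := by
  ext1 x
  rw [matS_apply, coordMul_apply, coordMul_apply, map_smul, matS_apply]

theorem coordMul_comm (u v : E3) (f : SchwartzSpinor) :
    coordMul u (coordMul v f) = coordMul v (coordMul u f) := by
  ext1 x
  simp only [coordMul_apply]
  rw [smul_comm]

theorem dirDeriv_coordMul (u v : E3) (f : SchwartzSpinor) :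
    dirDeriv v (coordMul u f) = coordMul u (dirDeriv v f) + ((inner ℝ u v : ℝ) : ℂ) • f := by
  ext1 x
  rw [_root_.add_apply, _root_.smul_apply, coordMul_apply, dirDeriv_apply,
    dirDeriv_apply]
  have hl : HasFDerivAt (fun x : E3 => ((inner ℝ u x : ℝ) : ℂ))
      (Complex.ofRealCLM ∘L innerSL ℝ u) x := (Complex.ofRealCLM ∘L innerSL ℝ u).hasFDerivAt
  have h := hl.smul f.differentiableAt.hasFDerivAt
  have h' : (coordMul u f : E3 → C8) = (fun x : E3 => ((inner ℝ u x : ℝ) : ℂ)) • (f : E3 → C8) := by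
    funext x; exact coordMul_apply u f x
  rw [h', h.fderiv]
  simp

theorem dirDeriv_comm (u v : E3) (f : SchwartzSpinor) :
    dirDeriv u (dirDeriv v f) = dirDeriv v (dirDeriv u f) := by
  have key : ∀ (u v : E3) (x : E3), dirDeriv u (dirDeriv v f) x =
      fderiv ℝ (fderiv ℝ f) x u v := by
    intro u v x
    rw [dirDeriv_apply]
    have hd : DifferentiableAt ℝ (fderiv ℝ f) x :=
      ((f.smooth 2).fderiv_right (m := 1) (by norm_num)).differentiable (by norm_num) x
    have h : HasFDerivAt (dirDeriv v f) ((ContinuousLinearMap.apply ℝ C8 v) ∘L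
        fderiv ℝ (fderiv ℝ f) x) x :=
      (ContinuousLinearMap.apply ℝ C8 v).hasFDerivAt.comp x hd.hasFDerivAt
    rw [h.fderiv]; rfl
  ext1 x
  rw [key, key]
  exact ((f.smooth 2).contDiffAt.isSymmSndFDerivAt (by simp)) u v

/-- The Hermitian product as a real bilinear map. -/
noncomputable def innerBilin : C8 →L[ℝ] C8 →L[ℝ] ℂ :=
  (LinearMap.mk₂ ℝ (fun x y : C8 => inner ℂ x y) inner_add_left
    (fun c x y => by rw [← Complex.coe_smul, inner_smul_left]; simp)
    inner_add_right
    (fun c x y => by rw [← Complex.coe_smul, inner_smul_right]; simp)).mkContinuous₂ 1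
    (fun x y => by simpa using norm_inner_le_norm x y)

theorem dirDeriv_antisymm (v : E3) (f g : SchwartzSpinor) :
    inner ℂ (schwartzIncl (dirDeriv v f)) (schwartzIncl g) =
      -inner ℂ (schwartzIncl f) (schwartzIncl (dirDeriv v g)) := by
  rw [inner_schwartzIncl, inner_schwartzIncl]
  have := SchwartzMap.integral_bilinear_lineDerivOp_right_eq_neg_left (μ := volume) f g innerBilin v
  exact (neg_eq_iff_eq_neg.2 this).symm

theorem coordMul_symm (u : E3) : SymmetricVia schwartzIncl (coordMul u) := fun f g => by
  rw [inner_schwartzIncl, inner_schwartzIncl]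
  refine integral_congr_ae (Eventually.of_forall fun x => ?_)
  simp only [coordMul_apply, inner_smul_left, inner_smul_right, Complex.conj_ofReal]

theorem inner_matS_left (B : Matrix (Fin 8) (Fin 8) ℝ) (f g : SchwartzSpinor) :
    inner ℂ (schwartzIncl (matS B f)) (schwartzIncl g) =
      inner ℂ (schwartzIncl f) (schwartzIncl (matS B.transpose g)) := by
  rw [inner_schwartzIncl, inner_schwartzIncl]
  refine integral_congr_ae (Eventually.of_forall fun x => ?_)
  simp only [matS_apply, inner_matC_left]

theorem matS_neg (B : Matrix (Fin 8) (Fin 8) ℝ) (f : SchwartzSpinor) :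
    matS (-B) f = -matS B f := by
  ext1 x
  rw [matS_apply, matC_neg]; rfl

/-! ### Gaussians and Hermite states -/

theorem one_add_pow_mul_exp_neg_sq_le (m : ℕ) {c : ℝ} (hc : 0 < c) :
    ∃ K : ℝ, ∀ t : ℝ, 0 ≤ t → (1 + t) ^ m * Real.exp (-(c * t ^ 2)) ≤ K := by
  refine ⟨m.factorial * (2 / c) ^ m * Real.exp c, fun t ht => ?_⟩
  have h1 : (1 + t) ^ m ≤ ((1 + t) ^ 2) ^ m :=
    pow_le_pow_left₀ (by positivity) (by nlinarith) m
  have h2 := Real.pow_div_factorial_le_exp (x := c / 2 * (1 + t) ^ 2) (by positivity) m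
  rw [div_le_iff₀ (by positivity), mul_pow] at h2
  have h3 : ((1 + t) ^ 2) ^ m ≤ (2 / c) ^ m * (Real.exp (c / 2 * (1 + t) ^ 2) * m.factorial) := by
    calc ((1 + t) ^ 2) ^ m = (2 / c) ^ m * ((c / 2) ^ m * ((1 + t) ^ 2) ^ m) := by
          rw [← mul_assoc, ← mul_pow]; field_simp; simp
      _ ≤ _ := by gcongr
  have h4 : Real.exp (c / 2 * (1 + t) ^ 2) * Real.exp (-(c * t ^ 2)) ≤ Real.exp c := by
    rw [← Real.exp_add]
    apply Real.exp_le_exp.2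
    nlinarith [mul_nonneg hc.le (sq_nonneg (1 - t))]
  calc (1 + t) ^ m * Real.exp (-(c * t ^ 2))
      ≤ ((2 / c) ^ m * (Real.exp (c / 2 * (1 + t) ^ 2) * m.factorial)) *
        Real.exp (-(c * t ^ 2)) := by gcongr; exact h1.trans h3
    _ = m.factorial * (2 / c) ^ m *
        (Real.exp (c / 2 * (1 + t) ^ 2) * Real.exp (-(c * t ^ 2))) := by ring
    _ ≤ _ := by gcongr

/-- `exp (-Q)` is a Schwartz function if `Q` has temperate growth and dominates a multiple of
`‖x‖ ^ 2`. -/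
noncomputable def expNegSchwartz (Q : E3 → ℝ) (hQ : Q.HasTemperateGrowth) (c : ℝ) (hc : 0 < c)
    (hQc : ∀ x, c * ‖x‖ ^ 2 ≤ Q x) : 𝓢(E3, ℝ) where
  toFun x := Real.exp (-Q x)
  smooth' := Real.contDiff_exp.comp hQ.1.neg
  decay' := by
    intro k n
    obtain ⟨l, C, hC, hbound⟩ := hQ.neg.norm_iteratedFDeriv_le_uniform n
    obtain ⟨K, hK⟩ := one_add_pow_mul_exp_neg_sq_le (k + l * n) hc
    refine ⟨n.factorial * (1 + C) ^ n * K, fun x => ?_⟩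
    have h1 : ‖iteratedFDeriv ℝ n (Real.exp ∘ (-Q)) x‖ ≤
        n.factorial * Real.exp (-Q x) * ((1 + C) * (1 + ‖x‖) ^ l) ^ n := by
      refine norm_iteratedFDeriv_comp_le (N := ∞) Real.contDiff_exp hQ.1.neg
        (by exact_mod_cast le_top) x (fun i _ => ?_) (fun i hi hin => ?_)
      · rw [norm_iteratedFDeriv_eq_norm_iteratedDeriv, iteratedDeriv_eq_iterate,
          Real.iter_deriv_exp, Real.norm_eq_abs, Real.abs_exp]
      · have hone : 1 ≤ (1 + C) * (1 + ‖x‖) ^ l :=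
          one_le_mul_of_one_le_of_one_le (by linarith)
            (one_le_pow₀ (by linarith [norm_nonneg x]))
        refine (hbound i hin x).trans (le_trans ?_ (le_self_pow₀ hone (by omega)))
        gcongr
        linarith
    have h2 : Real.exp (-Q x) ≤ Real.exp (-(c * ‖x‖ ^ 2)) :=
      Real.exp_le_exp.2 (neg_le_neg (hQc x))
    calc ‖x‖ ^ k * ‖iteratedFDeriv ℝ n (fun x => Real.exp (-Q x)) x‖
        ≤ (1 + ‖x‖) ^ k * (n.factorial * Real.exp (-(c * ‖x‖ ^ 2)) *
          ((1 + C) * (1 + ‖x‖) ^ l) ^ n) := by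
          gcongr
          · linarith [norm_nonneg x]
          · refine h1.trans ?_
            gcongr
      _ = n.factorial * (1 + C) ^ n *
          ((1 + ‖x‖) ^ (k + l * n) * Real.exp (-(c * ‖x‖ ^ 2))) := by
          rw [mul_pow, ← pow_mul, pow_add]; ring
      _ ≤ _ := by
          gcongr
          exact hK _ (norm_nonneg x)

/-- The quadratic form `½ ∑ w_a ⟪u_a, x⟫²`. -/
noncomputable def quadForm (u : OrthonormalBasis (Fin 3) ℝ E3) (w : Fin 3 → ℝ) (x : E3) : ℝ :=
  1 / 2 * ∑ a, w a * inner ℝ (u a) x ^ 2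

variable (u : OrthonormalBasis (Fin 3) ℝ E3) (w : Fin 3 → ℝ)

theorem quadForm_hasTemperateGrowth : (quadForm u w).HasTemperateGrowth := by
  have h : ∀ a, Function.HasTemperateGrowth (fun x : E3 => inner ℝ (u a) x) := fun a =>
    (innerSL ℝ (u a)).hasTemperateGrowth
  unfold quadForm
  fun_prop

theorem quadForm_ge (hw : ∀ a, 0 < w a) :
    ∃ c : ℝ, 0 < c ∧ ∀ x, c * ‖x‖ ^ 2 ≤ quadForm u w x := by
  obtain ⟨a, -, ha⟩ := Finset.univ.exists_min_image w ⟨0, Finset.mem_univ _⟩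
  refine ⟨1 / 2 * w a, by have := hw a; positivity, fun x => ?_⟩
  unfold quadForm
  have h1 : ‖x‖ ^ 2 = ∑ b, inner ℝ (u b) x ^ 2 := by
    rw [← u.sum_sq_norm_inner_right x]
    exact Finset.sum_congr rfl fun b _ => by rw [Real.norm_eq_abs, sq_abs]
  rw [h1, mul_assoc, Finset.mul_sum]
  gcongr with b
  exact ha b (Finset.mem_univ b)

theorem hasFDerivAt_quadForm (x : E3) :
    HasFDerivAt (quadForm u w) (∑ b, (w b * inner ℝ (u b) x) • innerSL ℝ (u b)) x := by
  unfold quadForm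
  have h : ∀ b, HasFDerivAt (fun x : E3 => w b * inner ℝ (u b) x ^ 2)
      ((w b * (2 * inner ℝ (u b) x)) • innerSL ℝ (u b)) x := fun b => by
    have h1 : HasFDerivAt (fun x : E3 => inner ℝ (u b) x) (innerSL ℝ (u b)) x :=
      (innerSL ℝ (u b)).hasFDerivAt
    have h2 := (h1.pow 2).const_mul (w b)
    refine h2.congr_fderiv ?_
    ext; simp; ring
  have h3 := (HasFDerivAt.fun_sum (u := Finset.univ) fun b _ => h b).const_mul (1 / 2)
  refine h3.congr_fderiv ?_
  rw [Finset.smul_sum]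
  refine Finset.sum_congr rfl fun b _ => ?_
  rw [smul_smul]; congr 1; ring

/-- The Gaussian `exp (-½ ∑ w_a ⟪u_a, x⟫²)` with values in the line through the spinor `s`. -/
noncomputable def gaussSpinor (hw : ∀ a, 0 < w a) (s : C8) : SchwartzSpinor :=
  SchwartzMap.postcompCLM (ContinuousLinearMap.toSpanSingleton ℝ s)
    (expNegSchwartz (quadForm u w) (quadForm_hasTemperateGrowth u w)
      (quadForm_ge u w hw).choose (quadForm_ge u w hw).choose_spec.1
      (quadForm_ge u w hw).choose_spec.2)

variable {u w}

theorem gaussSpinor_apply (hw : ∀ a, 0 < w a) (s : C8) (x : E3) :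
    gaussSpinor u w hw s x = ((Real.exp (-quadForm u w x) : ℝ) : ℂ) • s := by
  rw [Complex.coe_smul]; rfl

theorem dirDeriv_gaussSpinor (hw : ∀ a, 0 < w a) (s : C8) (a : Fin 3) :
    dirDeriv (u a) (gaussSpinor u w hw s) =
      -((w a : ℂ) • coordMul (u a) (gaussSpinor u w hw s)) := by
  ext1 x
  rw [dirDeriv_apply, _root_.neg_apply, _root_.smul_apply, coordMul_apply,
    gaussSpinor_apply]
  have h1 := ((hasFDerivAt_quadForm u w x).neg.exp).smul_const s
  have h2 : (gaussSpinor u w hw s : E3 → C8) = fun x => Real.exp ((-quadForm u w) x) • s := by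
    funext x; rw [gaussSpinor_apply, Complex.coe_smul]; rfl
  rw [h2, h1.fderiv]
  have h3 : (∑ b, (w b * inner ℝ (u b) x) • innerSL ℝ (u b)) (u a) = w a * inner ℝ (u a) x := by
    rw [_root_.sum_apply, Finset.sum_eq_single a]
    · simp
    · intro b _ hb
      simp [u.orthonormal.2 hb]
    · simp
  simp only [ContinuousLinearMap.smulRight_apply, _root_.smul_apply, _root_.neg_apply, h3,
    smul_eq_mul, Pi.neg_apply]
  rw [← Complex.coe_smul, smul_smul, smul_smul, ← neg_smul]
  congr 1
  push_cast
  ring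

variable (u w)

/-- The raising operator `w_a y_a - ∂_a` in the coordinate `y_a = ⟪u_a, x⟫`. -/
noncomputable def raiseOp (a : Fin 3) : Module.End ℂ SchwartzSpinor :=
  (w a : ℂ) • coordMul (u a) - dirDeriv (u a)

/-- The lowering operator `w_a y_a + ∂_a` in the coordinate `y_a = ⟪u_a, x⟫`. -/
noncomputable def lowerOp (a : Fin 3) : Module.End ℂ SchwartzSpinor :=
  (w a : ℂ) • coordMul (u a) + dirDeriv (u a)

theorem raiseOp_apply (a : Fin 3) (f : SchwartzSpinor) :
    raiseOp u w a f = (w a : ℂ) • coordMul (u a) f - dirDeriv (u a) f := rfl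

theorem lowerOp_apply (a : Fin 3) (f : SchwartzSpinor) :
    lowerOp u w a f = (w a : ℂ) • coordMul (u a) f + dirDeriv (u a) f := rfl

theorem inner_basis (a b : Fin 3) : inner ℝ (u a) (u b) = if a = b then 1 else 0 :=
  orthonormal_iff_ite.1 u.orthonormal a b

theorem raiseOp_comm (a b : Fin 3) : Commute (raiseOp u w a) (raiseOp u w b) := by
  ext1 f
  simp only [Module.End.mul_apply, raiseOp_apply, map_sub, map_smul, dirDeriv_coordMul,
    inner_basis, coordMul_comm (u b) (u a), dirDeriv_comm (u b) (u a)]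
  by_cases hab : a = b
  · subst hab; rfl
  · simp only [if_neg hab, if_neg (Ne.symm hab), Complex.ofReal_zero, zero_smul, add_zero]
    module

theorem lowerOp_raiseOp_comm {a b : Fin 3} (hab : a ≠ b) :
    Commute (lowerOp u w a) (raiseOp u w b) := by
  ext1 f
  simp only [Module.End.mul_apply, raiseOp_apply, lowerOp_apply, map_sub, map_add, map_smul,
    dirDeriv_coordMul, inner_basis, coordMul_comm (u b) (u a), dirDeriv_comm (u b) (u a), if_neg hab,
    if_neg (Ne.symm hab), Complex.ofReal_zero, zero_smul, add_zero]
  module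

theorem lowerOp_mul_raiseOp (a : Fin 3) :
    lowerOp u w a * raiseOp u w a = raiseOp u w a * lowerOp u w a + (2 * w a : ℂ) • 1 := by
  ext1 f
  simp only [Module.End.mul_apply, raiseOp_apply, lowerOp_apply, map_sub, map_add, map_smul,
    dirDeriv_coordMul, inner_basis, if_true, Complex.ofReal_one, one_smul, LinearMap.add_apply,
    LinearMap.smul_apply, Module.End.one_apply]
  module

theorem lowerOp_mul_raiseOp_pow (a : Fin 3) (m : ℕ) :
    lowerOp u w a * raiseOp u w a ^ m =
      raiseOp u w a ^ m * lowerOp u w a + (2 * w a * m : ℂ) • raiseOp u w a ^ (m - 1) := by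
  induction m with
  | zero => simp
  | succ m ih =>
    rw [pow_succ, ← mul_assoc, ih, add_mul, mul_assoc, lowerOp_mul_raiseOp, mul_add, ← mul_assoc,
      mul_smul_comm, mul_one, smul_mul_assoc, Nat.add_sub_cancel, add_assoc, ← pow_succ]
    congr 1
    rcases m with _ | m
    · simp
    · rw [Nat.add_sub_cancel, ← pow_succ]
      push_cast
      module

/-- The monomial `∏ (w_a y_a - ∂_a) ^ n_a` in the raising operators. -/
noncomputable def raiseMono (n : Fin 3 → ℕ) : Module.End ℂ SchwartzSpinor :=
  raiseOp u w 0 ^ n 0 * raiseOp u w 1 ^ n 1 * raiseOp u w 2 ^ n 2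

theorem raiseOp_mul_raiseMono (a : Fin 3) (n : Fin 3 → ℕ) :
    raiseOp u w a * raiseMono u w n = raiseMono u w (Function.update n a (n a + 1)) := by
  have c10 := ((raiseOp_comm u w 1 0).pow_right (n 0)).eq
  have c20 := ((raiseOp_comm u w 2 0).pow_right (n 0)).eq
  have c21 := ((raiseOp_comm u w 2 1).pow_right (n 1)).eq
  unfold raiseMono
  fin_cases a
  · simp [Function.update, pow_succ', mul_assoc]
  · simp only [Fin.mk_one, ← mul_assoc, c10]
    simp [Function.update, pow_succ', mul_assoc]
  · simp only [Fin.reduceFinMk, ← mul_assoc, c20]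
    rw [mul_assoc _ (raiseOp u w 2), c21]
    simp [Function.update, pow_succ', mul_assoc]

theorem lowerOp_mul_raiseMono (a : Fin 3) (n : Fin 3 → ℕ) :
    lowerOp u w a * raiseMono u w n = raiseMono u w n * lowerOp u w a +
      (2 * w a * n a : ℂ) • raiseMono u w (Function.update n a (n a - 1)) := by
  have c01 := ((lowerOp_raiseOp_comm u w (a := 0) (b := 1) (by decide)).pow_right (n 1)).eq
  have c02 := ((lowerOp_raiseOp_comm u w (a := 0) (b := 2) (by decide)).pow_right (n 2)).eq
  have c10 := ((lowerOp_raiseOp_comm u w (a := 1) (b := 0) (by decide)).pow_right (n 0)).eq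
  have c12 := ((lowerOp_raiseOp_comm u w (a := 1) (b := 2) (by decide)).pow_right (n 2)).eq
  have c20 := ((lowerOp_raiseOp_comm u w (a := 2) (b := 0) (by decide)).pow_right (n 0)).eq
  have c21 := ((lowerOp_raiseOp_comm u w (a := 2) (b := 1) (by decide)).pow_right (n 1)).eq
  have p0 := lowerOp_mul_raiseOp_pow u w 0 (n 0)
  have p1 := lowerOp_mul_raiseOp_pow u w 1 (n 1)
  have p2 := lowerOp_mul_raiseOp_pow u w 2 (n 2)
  unfold raiseMono
  fin_cases a
  · simp only [Fin.zero_eta, ← mul_assoc, p0, add_mul]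
    rw [mul_assoc _ (lowerOp u w 0), c01, ← mul_assoc, mul_assoc _ (lowerOp u w 0), c02]
    simp [Function.update, mul_assoc]
  · simp only [Fin.mk_one, ← mul_assoc, c10]
    rw [mul_assoc _ (lowerOp u w 1), p1, mul_add, add_mul, ← mul_assoc,
      mul_assoc _ (lowerOp u w 1), c12]
    simp [Function.update, mul_assoc]
  · simp only [Fin.reduceFinMk, ← mul_assoc, c20]
    rw [mul_assoc _ (lowerOp u w 2), c21, ← mul_assoc, mul_assoc _ (lowerOp u w 2), p2, mul_add]
    simp [Function.update, mul_assoc]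

/-- The Hermite state with excitation numbers `n` and values in the line through `s`. -/
noncomputable def hermiteState (hw : ∀ a, 0 < w a) (n : Fin 3 → ℕ) (s : C8) : SchwartzSpinor :=
  raiseMono u w n (gaussSpinor u w hw s)

variable {u w}

theorem raiseOp_hermiteState (hw : ∀ a, 0 < w a) (a : Fin 3) (n : Fin 3 → ℕ) (s : C8) :
    raiseOp u w a (hermiteState u w hw n s) =
      hermiteState u w hw (Function.update n a (n a + 1)) s := by
  unfold hermiteState
  rw [← raiseOp_mul_raiseMono, Module.End.mul_apply]

theorem lowerOp_hermiteState (hw : ∀ a, 0 < w a) (a : Fin 3) (n : Fin 3 → ℕ) (s : C8) :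
    lowerOp u w a (hermiteState u w hw n s) =
      (2 * w a * n a : ℂ) • hermiteState u w hw (Function.update n a (n a - 1)) s := by
  unfold hermiteState
  rw [← Module.End.mul_apply, lowerOp_mul_raiseMono, LinearMap.add_apply, Module.End.mul_apply,
    lowerOp_apply, dirDeriv_gaussSpinor, add_neg_cancel, map_zero, zero_add, LinearMap.smul_apply]

theorem matS_gaussSpinor (hw : ∀ a, 0 < w a) (B : Matrix (Fin 8) (Fin 8) ℝ) (s : C8) :
    matS B (gaussSpinor u w hw s) = gaussSpinor u w hw (matC B s) := by
  ext1 x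
  rw [matS_apply, gaussSpinor_apply, gaussSpinor_apply, map_smul]

theorem matS_hermiteState (hw : ∀ a, 0 < w a) (B : Matrix (Fin 8) (Fin 8) ℝ) (n : Fin 3 → ℕ)
    (s : C8) : matS B (hermiteState u w hw n s) = hermiteState u w hw n (matC B s) := by
  have h1 : ∀ a, Commute (show Module.End ℂ SchwartzSpinor from matS B) (raiseOp u w a) := by
    intro a
    ext1 f
    simp only [Module.End.mul_apply, raiseOp_apply, map_sub, map_smul, matS_dirDeriv,
      matS_coordMul]
  have h2 : Commute (show Module.End ℂ SchwartzSpinor from matS B) (raiseMono u w n) :=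
    (((h1 0).pow_right _).mul_right ((h1 1).pow_right _)).mul_right ((h1 2).pow_right _)
  have h3 := LinearMap.congr_fun h2.eq (gaussSpinor u w hw s)
  simp only [Module.End.mul_apply, matS_gaussSpinor] at h3
  exact h3

theorem hermiteState_smul (hw : ∀ a, 0 < w a) (n : Fin 3 → ℕ) (c : ℂ) (s : C8) :
    hermiteState u w hw n (c • s) = c • hermiteState u w hw n s := by
  unfold hermiteState
  rw [← map_smul]
  congr 1
  ext1 x
  rw [_root_.smul_apply, gaussSpinor_apply, gaussSpinor_apply, smul_comm]

theorem hermiteState_ne_zero (hw : ∀ a, 0 < w a) {s : C8} (hs : s ≠ 0) (n : Fin 3 → ℕ) :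
    hermiteState u w hw n s ≠ 0 := by
  induction hm : ∑ a, n a generalizing n with
  | zero =>
    have hn : n = 0 := funext fun a => by
      simpa using (Finset.sum_eq_zero_iff.1 hm) a (Finset.mem_univ a)
    intro h0
    have h1 := congrArg (fun f : SchwartzSpinor => f 0) h0
    simp only [hn, hermiteState, raiseMono, Pi.zero_apply, pow_zero, one_mul, Module.End.one_apply,
      gaussSpinor_apply, _root_.zero_apply, smul_eq_zero, Complex.ofReal_eq_zero] at h1
    exact h1.elim (Real.exp_pos _).ne' hs
  | succ m ih =>
    obtain ⟨a, ha⟩ : ∃ a, n a ≠ 0 := by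
      by_contra! h
      simp [h] at hm
    intro h0
    have h1 := lowerOp_hermiteState hw a n s (u := u)
    rw [h0, map_zero] at h1
    have h2 : (2 * w a * n a : ℂ) ≠ 0 := by
      have := (hw a).ne'
      have h3 : (w a : ℂ) ≠ 0 := Complex.ofReal_ne_zero.2 this
      have h4 : (n a : ℂ) ≠ 0 := Nat.cast_ne_zero.2 ha
      exact mul_ne_zero (mul_ne_zero two_ne_zero h3) h4
    refine ih (Function.update n a (n a - 1)) ?_ ((smul_eq_zero.1 h1.symm).resolve_left h2)
    rw [Finset.sum_update_of_mem (Finset.mem_univ a)]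
    rw [← Finset.add_sum_erase _ _ (Finset.mem_univ a)] at hm
    rw [Finset.sdiff_singleton_eq_erase]
    omega

end Schwartz

/-! ### Completeness of the Hermite states -/

section Completeness

open scoped SchwartzMap FourierTransform

/-- An integrable function with vanishing Fourier transform vanishes: its integral against any
test function is that of its Fourier transform against the inverse transform. -/
theorem ae_eq_zero_of_fourier_eq_zero {V : Type*} [NormedAddCommGroup V] [InnerProductSpace ℝ V]
    [FiniteDimensional ℝ V] [MeasurableSpace V] [BorelSpace V] {G : V → ℂ} (hG : Integrable G)
    (h : ∀ t, 𝓕 G t = 0) : ∀ᵐ x, G x = 0 := by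
  refine ae_eq_zero_of_integral_contDiff_smul_eq_zero hG.locallyIntegrable fun φ hφ hφc => ?_
  let φS : 𝓢(V, ℂ) := (hφc.comp_left (g := fun r : ℝ => (r : ℂ)) rfl).toSchwartzMap
    (Complex.ofRealCLM.contDiff.comp hφ)
  have h1 : ∀ x, φ x • G x = (𝓕 (𝓕⁻ φS : 𝓢(V, ℂ)) : 𝓢(V, ℂ)) x • G x := fun x => by
    rw [FourierTransform.fourier_fourierInv_eq]
    change φ x • G x = ((φ x : ℝ) : ℂ) • G x
    rw [Complex.coe_smul]
  simp_rw [h1]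
  have h2 := VectorFourier.integral_fourierIntegral_smul_eq_flip (L := innerₗ V)
    (μ := volume) (ν := volume)
    Real.continuous_fourierChar continuous_inner (𝓕⁻ φS : 𝓢(V, ℂ)).integrable hG
  have h3 : ∀ x, VectorFourier.fourierIntegral Real.fourierChar volume (innerₗ V).flip G x = 0 := by
    intro x
    rw [flip_innerₗ]
    exact h x
  simp only [h3, smul_zero, integral_zero] at h2
  rw [← h2]
  refine integral_congr_ae (Eventually.of_forall fun x => ?_)
  simp only [SchwartzMap.fourier_coe]
  rfl

variable (u : OrthonormalBasis (Fin 3) ℝ E3) (w : Fin 3 → ℝ)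

theorem continuous_quadForm : Continuous (quadForm u w) :=
  (quadForm_hasTemperateGrowth u w).1.continuous

theorem integrable_exp_mul_gaussian_mul (hw : ∀ a, 0 < w a) {g : E3 → ℂ} (hg : MemLp g 2) (c : ℝ) :
    Integrable fun x => Real.exp (c * ‖x‖) * ‖(Real.exp (-quadForm u w x) : ℂ) * g x‖ := by
  -- Half of the quadratic form absorbs the exponential factor.
  set w' : Fin 3 → ℝ := fun a => w a / 2 with hw'
  have hw'pos : ∀ a, 0 < w' a := fun a => half_pos (hw a)
  obtain ⟨c₀, hc₀, hle⟩ := quadForm_ge u w' hw'pos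
  have hsplit : ∀ x, quadForm u w x = quadForm u w' x + quadForm u w' x := fun x => by
    unfold quadForm
    rw [← mul_add, ← Finset.sum_add_distrib]
    congr 1
    refine Finset.sum_congr rfl fun a _ => ?_
    simp only [hw']; ring
  have hS : MemLp (fun x => Real.exp (-quadForm u w' x)) 2 (volume : Measure E3) :=
    (expNegSchwartz (quadForm u w') (quadForm_hasTemperateGrowth u w') c₀ hc₀ hle).memLp 2
      (volume : Measure E3)
  have hint : Integrable fun x => Real.exp (-quadForm u w' x) * ‖g x‖ :=
    hS.integrable_mul hg.norm
  refine (hint.const_mul (Real.exp (c ^ 2 / (4 * c₀)))).mono' ?_ (Eventually.of_forall fun x => ?_)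
  · have h1 : Continuous fun x : E3 => Real.exp (c * ‖x‖) := by fun_prop
    have h2 : Continuous fun x : E3 => (Real.exp (-quadForm u w x) : ℂ) := by
      have := continuous_quadForm u w
      fun_prop
    exact h1.aestronglyMeasurable.mul (h2.aestronglyMeasurable.mul hg.1).norm
  · rw [Real.norm_eq_abs, abs_of_nonneg (by positivity), norm_mul, Complex.norm_real,
      Real.norm_eq_abs, Real.abs_exp, ← mul_assoc, ← mul_assoc, ← Real.exp_add, ← Real.exp_add]
    refine mul_le_mul_of_nonneg_right (Real.exp_le_exp.2 ?_) (norm_nonneg _)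
    have h1 := hle x
    have h2 := hsplit x
    have h3 : c * ‖x‖ ≤ c ^ 2 / (4 * c₀) + c₀ * ‖x‖ ^ 2 := by
      have h4 : c ^ 2 / (4 * c₀) + c₀ * ‖x‖ ^ 2 - c * ‖x‖ =
          (c / 2 - c₀ * ‖x‖) ^ 2 / c₀ := by field_simp; ring
      have h5 : 0 ≤ (c / 2 - c₀ * ‖x‖) ^ 2 / c₀ := by positivity
      linarith
    linarith

/-- A square integrable function orthogonal to all powers of linear functions times a Gaussian
vanishes: expanding the exponential shows that its product with the Gaussian has vanishing Fourier
transform. -/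
theorem ae_eq_zero_of_moments_eq_zero (hw : ∀ a, 0 < w a) {g : E3 → ℂ} (hg : MemLp g 2)
    (hmom : ∀ (t : E3) (k : ℕ),
      ∫ x, ((inner ℝ t x : ℝ) : ℂ) ^ k * ((Real.exp (-quadForm u w x) : ℂ) * g x) = 0) :
    ∀ᵐ x, g x = 0 := by
  set G : E3 → ℂ := fun x => (Real.exp (-quadForm u w x) : ℂ) * g x with hGdef
  have hGm : AEStronglyMeasurable G := by
    have h2 : Continuous fun x : E3 => (Real.exp (-quadForm u w x) : ℂ) := by
      have := continuous_quadForm u w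
      fun_prop
    exact h2.aestronglyMeasurable.mul hg.1
  have hexp := integrable_exp_mul_gaussian_mul u w hw hg
  have hG : Integrable G := by
    have := hexp 0
    simp only [zero_mul, Real.exp_zero, one_mul] at this
    exact (integrable_norm_iff hGm).1 this
  have hz : ∀ t, 𝓕 G t = 0 := by
    intro t
    rw [Real.fourier_eq']
    set F : ℕ → E3 → ℂ := fun k x =>
      ((k.factorial : ℂ)⁻¹ * (-2 * Real.pi * Complex.I) ^ k) *
        (((inner ℝ t x : ℝ) : ℂ) ^ k * G x) with hF
    have hsum : HasSum (fun k => ∫ x, F k x)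
        (∫ x, Complex.exp (((-2 * Real.pi * inner ℝ x t : ℝ) : ℂ) * Complex.I) • G x) := by
      have hb : ∀ x, HasSum (fun k : ℕ =>
          (k.factorial : ℝ)⁻¹ * (2 * Real.pi * ‖t‖ * ‖x‖) ^ k * ‖G x‖)
          (Real.exp (2 * Real.pi * ‖t‖ * ‖x‖) * ‖G x‖) := fun x => by
        have := (NormedSpace.expSeries_div_hasSum_exp (2 * Real.pi * ‖t‖ * ‖x‖)).mul_right ‖G x‖
        rw [← Real.exp_eq_exp_ℝ] at this
        have e : (fun k : ℕ => (k.factorial : ℝ)⁻¹ * (2 * Real.pi * ‖t‖ * ‖x‖) ^ k * ‖G x‖) =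
            fun k : ℕ => (2 * Real.pi * ‖t‖ * ‖x‖) ^ k / k.factorial * ‖G x‖ := by
          funext k; ring
        rw [e]; exact this
      refine hasSum_integral_of_dominated_convergence
        (fun k x => (k.factorial : ℝ)⁻¹ * (2 * Real.pi * ‖t‖ * ‖x‖) ^ k * ‖G x‖)
        (fun k => ?_) (fun k => Eventually.of_forall fun x => ?_)
        (Eventually.of_forall fun x => (hb x).summable) ?_ (Eventually.of_forall fun x => ?_)
      · have hc : Continuous fun x : E3 => ((inner ℝ t x : ℝ) : ℂ) ^ k := by fun_prop
        exact (hc.aestronglyMeasurable.mul hGm).const_mul _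
      · simp only [hF, norm_mul, norm_inv, norm_pow, norm_neg, Complex.norm_natCast,
          Complex.norm_real, Complex.norm_I, mul_one, Complex.norm_ofNat, Real.norm_eq_abs,
          abs_of_pos Real.pi_pos]
        have h1 : |inner ℝ t x| ≤ ‖t‖ * ‖x‖ := abs_real_inner_le_norm t x
        calc (k.factorial : ℝ)⁻¹ * (2 * Real.pi) ^ k * (|inner ℝ t x| ^ k * ‖G x‖)
            ≤ (k.factorial : ℝ)⁻¹ * (2 * Real.pi) ^ k * ((‖t‖ * ‖x‖) ^ k * ‖G x‖) := by gcongr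
          _ = _ := by rw [mul_assoc (2 * Real.pi), mul_pow (2 * Real.pi)]; ring
      · simp only [(hb _).tsum_eq]
        exact hexp (2 * Real.pi * ‖t‖)
      · have h1 := (NormedSpace.expSeries_div_hasSum_exp
          (((-2 * Real.pi * inner ℝ x t : ℝ) : ℂ) * Complex.I)).mul_right (G x)
        rw [← Complex.exp_eq_exp_ℂ] at h1
        have e : (fun k => F k x) = fun k : ℕ =>
            (((-2 * Real.pi * inner ℝ x t : ℝ) : ℂ) * Complex.I) ^ k / k.factorial * G x := by
          funext k
          simp only [hF, real_inner_comm x t]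
          rw [div_eq_inv_mul, show (((-2 * Real.pi * inner ℝ x t : ℝ) : ℂ) * Complex.I) =
            (-2 * Real.pi * Complex.I) * ((inner ℝ x t : ℝ) : ℂ) by push_cast; ring, mul_pow]
          ring
        rw [e]; exact h1
    have hzero : ∀ k, ∫ x, F k x = 0 := fun k => by
      simp only [hF]
      rw [integral_const_mul, hmom t k, mul_zero]
    simp only [hzero] at hsum
    exact hsum.unique hasSum_zero
  filter_upwards [ae_eq_zero_of_fourier_eq_zero hG hz] with x hx
  exact (mul_eq_zero.1 hx).resolve_left (Complex.ofReal_ne_zero.2 (Real.exp_pos _).ne')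

variable {u w}

theorem coordMul_basis_hermiteState (hw : ∀ a, 0 < w a) (a : Fin 3) (n : Fin 3 → ℕ) (s : C8) :
    coordMul (u a) (hermiteState u w hw n s) ∈
      Submodule.span ℂ (Set.range fun n => hermiteState u w hw n s) := by
  have h1 : (2 * w a : ℂ) • coordMul (u a) (hermiteState u w hw n s) =
      raiseOp u w a (hermiteState u w hw n s) + lowerOp u w a (hermiteState u w hw n s) := by
    rw [raiseOp_apply, lowerOp_apply]; module
  have h2 : (2 * w a : ℂ) ≠ 0 :=
    mul_ne_zero two_ne_zero (Complex.ofReal_ne_zero.2 (hw a).ne')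
  refine (Submodule.smul_mem_iff _ h2).1 ?_
  rw [h1, raiseOp_hermiteState, lowerOp_hermiteState]
  exact Submodule.add_mem _ (Submodule.subset_span ⟨_, rfl⟩)
    (Submodule.smul_mem _ _ (Submodule.subset_span ⟨_, rfl⟩))

theorem coordMul_mem_span_hermiteState (hw : ∀ a, 0 < w a) (t : E3) (s : C8) {f : SchwartzSpinor}
    (hf : f ∈ Submodule.span ℂ (Set.range fun n => hermiteState u w hw n s)) :
    coordMul t f ∈ Submodule.span ℂ (Set.range fun n => hermiteState u w hw n s) := by
  have ht : coordMul t f = ∑ a, ((inner ℝ (u a) t : ℝ) : ℂ) • coordMul (u a) f := by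
    ext1 x
    rw [_root_.sum_apply]
    simp only [_root_.smul_apply, coordMul_apply, smul_smul, ← Finset.sum_smul]
    congr 1
    rw [← u.sum_inner_mul_inner t x]
    push_cast
    refine Finset.sum_congr rfl fun a _ => ?_
    rw [real_inner_comm]
  rw [ht]
  refine Submodule.sum_mem _ fun a _ => Submodule.smul_mem _ _ ?_
  clear ht
  induction hf using Submodule.span_induction with
  | mem x hx =>
    obtain ⟨n, rfl⟩ := hx
    exact coordMul_basis_hermiteState hw a n s
  | zero => simp
  | add x y _ _ hx hy => rw [map_add]; exact Submodule.add_mem _ hx hy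
  | smul c x _ hx => rw [map_smul]; exact Submodule.smul_mem _ _ hx

theorem inner_spinor_ae_eq_zero (hw : ∀ a, 0 < w a) (s : C8) (f : HilbL)
    (hf : ∀ n, inner ℂ (schwartzIncl (hermiteState u w hw n s)) f = 0) :
    ∀ᵐ x, inner ℂ s (f x) = 0 := by
  have hg : MemLp (fun x => inner ℂ s (f x)) 2 := (innerSL ℂ s).comp_memLp' (Lp.memLp f)
  refine ae_eq_zero_of_moments_eq_zero u w hw hg fun t k => ?_
  have hspan : ∀ k, ((coordMul t)^[k]) (gaussSpinor u w hw s) ∈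
      Submodule.span ℂ (Set.range fun n => hermiteState u w hw n s) := by
    intro k
    induction k with
    | zero =>
      refine Submodule.subset_span ⟨0, ?_⟩
      simp [hermiteState, raiseMono]
    | succ k ih =>
      rw [Function.iterate_succ_apply']
      exact coordMul_mem_span_hermiteState hw t s ih
  have hval : ∀ (k : ℕ) (x : E3), ((coordMul t)^[k]) (gaussSpinor u w hw s) x =
      (((inner ℝ t x : ℝ) : ℂ) ^ k * (Real.exp (-quadForm u w x) : ℂ)) • s := by
    intro k
    induction k with
    | zero => intro x; rw [Function.iterate_zero, id, gaussSpinor_apply, pow_zero, one_mul]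
    | succ k ih =>
      intro x
      rw [Function.iterate_succ_apply', coordMul_apply, ih, smul_smul, pow_succ']
      congr 1; ring
  have horth : ∀ p ∈ Submodule.span ℂ (Set.range fun n => hermiteState u w hw n s),
      inner ℂ (schwartzIncl p) f = 0 := by
    intro p hp
    induction hp using Submodule.span_induction with
    | mem x hx => obtain ⟨n, rfl⟩ := hx; exact hf n
    | zero => simp
    | add x y _ _ hx hy => rw [map_add, inner_add_left, hx, hy, add_zero]
    | smul c x _ hx => rw [map_smul, inner_smul_left, hx, mul_zero]
  have h0 := horth _ (hspan k)
  rw [L2.inner_def] at h0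
  rw [← h0]
  refine integral_congr_ae ?_
  filter_upwards [SchwartzMap.coeFn_toLp (((coordMul t)^[k]) (gaussSpinor u w hw s)) 2 volume]
    with x hx
  change _ = inner ℂ ((SchwartzMap.toLp (((coordMul t)^[k]) (gaussSpinor u w hw s)) 2 volume) x) _
  rw [hx, hval, inner_smul_left, map_mul, map_pow, Complex.conj_ofReal, Complex.conj_ofReal]
  ring

/-- Hermite states with values in spinors that span `ℂ⁸` are total in `L²`. -/
theorem closure_span_hermiteState_eq_top (hw : ∀ a, 0 < w a) {κ : Type*} [Countable κ] (s : κ → C8)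
    (hs : Submodule.span ℂ (Set.range s) = ⊤) :
    (Submodule.span ℂ (Set.range fun p : (Fin 3 → ℕ) × κ =>
      schwartzIncl (hermiteState u w hw p.1 (s p.2)))).topologicalClosure = ⊤ := by
  rw [Submodule.topologicalClosure_eq_top_iff, Submodule.eq_bot_iff]
  intro f hf
  have h1 : ∀ j, ∀ᵐ x, inner ℂ (s j) (f x) = 0 := fun j =>
    inner_spinor_ae_eq_zero hw (s j) f fun n =>
      (Submodule.mem_orthogonal _ _).1 hf _ (Submodule.subset_span ⟨(n, j), rfl⟩)
  have h2 : ∀ᵐ x, ∀ j, inner ℂ (s j) (f x) = 0 := ae_all_iff.2 h1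
  rw [Lp.eq_zero_iff_ae_eq_zero]
  filter_upwards [h2] with x hx
  have h3 : f x ∈ (Submodule.span ℂ (Set.range s))ᗮ := by
    rw [Submodule.mem_orthogonal]
    intro y hy
    induction hy using Submodule.span_induction with
    | mem y hy => obtain ⟨j, rfl⟩ := hy; exact hx j
    | zero => simp
    | add y z _ _ hy hz => rw [inner_add_left, hy, hz, add_zero]
    | smul c y _ hy => rw [inner_smul_left, hy, mul_zero]
  rw [hs, Submodule.top_orthogonal_eq_bot] at h3
  exact h3

end Completeness

/-! ### The components of the Dirac operator -/

section Components

variable {γ : Fin 3 → Matrix (Fin 8) (Fin 8) ℝ} {γs : Matrix (Fin 8) (Fin 8) ℝ}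
  {ρ : Fin 3 → Matrix (Fin 8) (Fin 8) ℝ} {u : OrthonormalBasis (Fin 3) ℝ E3} {w : Fin 3 → ℝ}

/-- The one-dimensional Dirac operator `γ_a ∂_{u_a} + i w_a ⟪u_a, x⟫ ρ_a`. -/
noncomputable def diracComponent (γ ρ : Fin 3 → Matrix (Fin 8) (Fin 8) ℝ)
    (u : OrthonormalBasis (Fin 3) ℝ E3) (w : Fin 3 → ℝ) (a : Fin 3) :
    SchwartzSpinor →ₗ[ℂ] SchwartzSpinor :=
  matS (γ a) ∘ₗ dirDeriv (u a) + (Complex.I * w a) • (coordMul (u a) ∘ₗ matS (ρ a))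

theorem diracComponent_apply (a : Fin 3) (f : SchwartzSpinor) :
    diracComponent γ ρ u w a f =
      matS (γ a) (dirDeriv (u a) f) + (Complex.I * w a) • coordMul (u a) (matS (ρ a) f) := rfl

theorem matS_anticomm {A B : Matrix (Fin 8) (Fin 8) ℝ} (h : A * B + B * A = 0)
    (f : SchwartzSpinor) : matS A (matS B f) = -matS B (matS A f) := by
  ext1 x
  simp only [_root_.neg_apply, matS_apply]
  exact IsCliffordSystem.matC_anticomm h (f x)

namespace IsCliffordSystem

theorem diracComponent_symm (h : IsCliffordSystem γ γs ρ) (a : Fin 3) :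
    SymmetricVia schwartzIncl (diracComponent γ ρ u w a) := fun f g => by
  simp only [diracComponent_apply, map_add, map_smul, inner_add_left, inner_add_right,
    inner_smul_left, inner_smul_right, inner_matS_left, dirDeriv_antisymm, coordMul_symm _ _ _,
    h.γ_antisymm, h.ρ_antisymm, matS_neg, map_neg, inner_neg_right, matS_dirDeriv, matS_coordMul,
    map_mul, Complex.conj_I, Complex.conj_ofReal]
  ring

theorem diracComponent_anticomm (h : IsCliffordSystem γ γs ρ) {a b : Fin 3} (hab : a ≠ b)
    (f : SchwartzSpinor) : diracComponent γ ρ u w a (diracComponent γ ρ u w b f) =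
      -diracComponent γ ρ u w b (diracComponent γ ρ u w a f) := by
  have gg := matS_anticomm (A := γ a) (B := γ b) (by rw [h.γ_γ, if_neg hab])
  have rr := matS_anticomm (A := ρ a) (B := ρ b) (by rw [h.ρ_ρ, if_neg hab])
  have rg := matS_anticomm (h.ρ_γ a b)
  have rg' := matS_anticomm (h.ρ_γ b a)
  simp only [diracComponent_apply, map_add, map_smul, matS_dirDeriv, matS_coordMul,
    dirDeriv_coordMul, inner_basis, if_neg hab, if_neg hab.symm, Complex.ofReal_zero, zero_smul,
    add_zero, gg, rr, rg, rg', map_neg, dirDeriv_comm (u a) (u b), coordMul_comm (u a) (u b)]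
  module

theorem diracComponent_hermiteState (h : IsCliffordSystem γ γs ρ) (hw : ∀ a, 0 < w a) (a : Fin 3)
    (n : Fin 3 → ℕ) (s : C8) : diracComponent γ ρ u w a (hermiteState u w hw n s) =
      dirDeriv (u a) (hermiteState u w hw n (matC (γ a) s)) +
        (w a : ℂ) • coordMul (u a)
          (hermiteState u w hw n ((-1 : ℂ) • matC (γ a) (chirality γ ρ a s))) := by
  have h1 := h.I_smul_ρ a s
  rw [← neg_one_smul ℂ] at h1
  rw [diracComponent_apply, matS_dirDeriv, matS_hermiteState, matS_hermiteState, ← h1,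
    hermiteState_smul, map_smul, smul_smul, mul_comm Complex.I]

theorem diracComponent_of_neg (h : IsCliffordSystem γ γs ρ) (hw : ∀ a, 0 < w a) {a : Fin 3}
    (n : Fin 3 → ℕ) {s : C8} (hs : chirality γ ρ a s = -s) :
    diracComponent γ ρ u w a (hermiteState u w hw n s) =
      (2 * w a * n a : ℂ) •
        hermiteState u w hw (Function.update n a (n a - 1)) (matC (γ a) s) := by
  rw [h.diracComponent_hermiteState, hs, map_neg, smul_neg, neg_one_smul, neg_neg,
    ← lowerOp_hermiteState, lowerOp_apply, add_comm]

theorem diracComponent_of_pos (h : IsCliffordSystem γ γs ρ) (hw : ∀ a, 0 < w a) {a : Fin 3}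
    (n : Fin 3 → ℕ) {s : C8} (hs : chirality γ ρ a s = s) :
    diracComponent γ ρ u w a (hermiteState u w hw n s) =
      -hermiteState u w hw (Function.update n a (n a + 1)) (matC (γ a) s) := by
  rw [h.diracComponent_hermiteState, hs, hermiteState_smul, ← raiseOp_hermiteState, raiseOp_apply,
    map_smul]
  module

/-- The chirality acting pointwise on Schwartz spinors. -/
noncomputable def chiralityS (γ ρ : Fin 3 → Matrix (Fin 8) (Fin 8) ℝ) (a : Fin 3) :
    SchwartzSpinor →ₗ[ℂ] SchwartzSpinor :=
  Complex.I • (matS (γ a) ∘ₗ matS (ρ a))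

theorem chiralityS_symm (h : IsCliffordSystem γ γs ρ) (a : Fin 3) :
    SymmetricVia schwartzIncl (chiralityS γ ρ a) := fun f g => by
  have rg := matS_anticomm (h.ρ_γ a a)
  simp only [chiralityS, LinearMap.smul_apply, LinearMap.comp_apply, map_smul, inner_smul_left,
    inner_smul_right, inner_matS_left, h.γ_antisymm, h.ρ_antisymm, matS_neg, map_neg,
    inner_neg_right, rg, Complex.conj_I]
  ring

theorem chiralityS_hermiteState (hw : ∀ a, 0 < w a) (a : Fin 3) (n : Fin 3 → ℕ) (s : C8) :
    chiralityS γ ρ a (hermiteState u w hw n s) = hermiteState u w hw n (chirality γ ρ a s) := by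
  simp only [chiralityS, LinearMap.smul_apply, LinearMap.comp_apply, matS_hermiteState,
    chirality_apply, hermiteState_smul]

theorem chirality_spinor_zero (h : IsCliffordSystem γ γs ρ) {δ : Fin 3 → Fin 2} {a : Fin 3}
    (hδ : δ a = 0) : chirality γ ρ a (h.spinor δ) = -h.spinor δ := by
  rw [h.chirality_spinor, if_pos hδ, neg_one_smul]

theorem chirality_spinor_one (h : IsCliffordSystem γ γs ρ) {δ : Fin 3 → Fin 2} {a : Fin 3}
    (hδ : δ a ≠ 0) : chirality γ ρ a (h.spinor δ) = h.spinor δ := by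
  rw [h.chirality_spinor, if_neg hδ, one_smul]

theorem diracComponent_sq (h : IsCliffordSystem γ γs ρ) (hw : ∀ a, 0 < w a) (a : Fin 3)
    (n : Fin 3 → ℕ) (δ : Fin 3 → Fin 2) :
    diracComponent γ ρ u w a (diracComponent γ ρ u w a (hermiteState u w hw n (h.spinor δ))) =
      ((2 * w a * (δ a + n a : ℕ) : ℝ) : ℂ) • hermiteState u w hw n (h.spinor δ) := by
  by_cases hδ : δ a = 0
  · have hc := h.chirality_spinor_zero hδ
    have hc' : chirality γ ρ a (matC (γ a) (h.spinor δ)) = matC (γ a) (h.spinor δ) := by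
      rw [h.chirality_γ_self, hc, map_neg, neg_neg]
    rw [h.diracComponent_of_neg hw n hc, map_smul, h.diracComponent_of_pos hw _ hc', h.γ_sq,
      Function.update_self, Function.update_idem, ← neg_one_smul ℂ (h.spinor δ),
      hermiteState_smul, neg_one_smul, neg_neg, hδ]
    rcases Nat.eq_zero_or_pos (n a) with h0 | h0
    · simp [h0]
    · rw [Nat.sub_add_cancel h0, Function.update_eq_self]
      simp
  · have hδ1 : δ a = 1 := by
      have : ∀ i : Fin 2, i ≠ 0 → i = 1 := by decide
      exact this _ hδ
    have hc := h.chirality_spinor_one hδ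
    have hc' : chirality γ ρ a (matC (γ a) (h.spinor δ)) = -matC (γ a) (h.spinor δ) := by
      rw [h.chirality_γ_self, hc]
    rw [h.diracComponent_of_pos hw n hc, map_neg, h.diracComponent_of_neg hw _ hc', h.γ_sq,
      Function.update_self, Function.update_idem, ← neg_one_smul ℂ (h.spinor δ),
      hermiteState_smul, neg_one_smul, smul_neg, neg_neg, hδ1, Nat.add_sub_cancel,
      Function.update_eq_self]
    congr 1
    push_cast
    simp [add_comm]

theorem inner_hermiteState (h : IsCliffordSystem γ γs ρ) (hw : ∀ a, 0 < w a)
    {n n' : Fin 3 → ℕ} {δ δ' : Fin 3 → Fin 2} (hne : (n, δ) ≠ (n', δ')) :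
    inner ℂ (schwartzIncl (hermiteState u w hw n (h.spinor δ)))
      (schwartzIncl (hermiteState u w hw n' (h.spinor δ'))) = 0 := by
  by_cases hδ : δ = δ'
  · subst hδ
    have hn : n ≠ n' := fun hn => hne (by rw [hn])
    obtain ⟨a, ha⟩ := Function.ne_iff.1 hn
    have hS : SymmetricVia schwartzIncl (diracComponent γ ρ u w a) := h.diracComponent_symm a
    have e := h.diracComponent_sq (u := u) hw a n δ
    have e' := h.diracComponent_sq (u := u) hw a n' δ
    rw [← LinearMap.comp_apply] at e e'
    refine hS.comp_self.inner_eq_zero e e' fun hh => ?_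
    have h1 : (2 * w a) ≠ 0 := mul_ne_zero two_ne_zero (hw a).ne'
    have h2 : (δ a + n a : ℕ) = (δ a + n' a : ℕ) := by
      exact_mod_cast mul_left_cancel₀ h1 hh
    exact ha (by omega)
  · obtain ⟨a, ha⟩ := Function.ne_iff.1 hδ
    have hS := h.chiralityS_symm a
    have e : ∀ (n : Fin 3 → ℕ) (δ : Fin 3 → Fin 2), δ a = 0 →
        chiralityS γ ρ a (hermiteState u w hw n (h.spinor δ)) =
          ((-1 : ℝ) : ℂ) • hermiteState u w hw n (h.spinor δ) := fun n δ h0 => by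
      rw [chiralityS_hermiteState, h.chirality_spinor_zero h0, ← neg_one_smul ℂ,
        hermiteState_smul]
      simp
    have e' : ∀ (n : Fin 3 → ℕ) (δ : Fin 3 → Fin 2), δ a ≠ 0 →
        chiralityS γ ρ a (hermiteState u w hw n (h.spinor δ)) =
          ((1 : ℝ) : ℂ) • hermiteState u w hw n (h.spinor δ) := fun n δ h0 => by
      rw [chiralityS_hermiteState, h.chirality_spinor_one h0]
      simp
    by_cases h0 : δ a = 0
    · exact hS.inner_eq_zero (e n δ h0) (e' n' δ' (h0 ▸ ha.symm)) (by norm_num)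
    · have h0' : δ' a = 0 := by
        have : ∀ i j : Fin 2, i ≠ j → i ≠ 0 → j = 0 := by decide
        exact this _ _ ha h0
      exact hS.inner_eq_zero (e' n δ h0) (e n' δ' h0') (by norm_num)

/-- The Hermite states with values in the spinors of a Clifford system form a ladder for the
components of the Dirac operator. -/
theorem isLadder (h : IsCliffordSystem γ γs ρ) (hw : ∀ a, 0 < w a) :
    IsLadder schwartzIncl (diracComponent γ ρ u w) w
      (fun n δ => hermiteState u w hw n (h.spinor δ)) where
  pos := hw
  symm := h.diracComponent_symm
  anti := fun a b hab f => h.diracComponent_anticomm hab f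
  sq := h.diracComponent_sq hw
  vanish := fun a n δ h0 => by
    have hδ : δ a = 0 := Fin.ext (by simp; omega)
    rw [h.diracComponent_of_neg hw n (h.chirality_spinor_zero hδ)]
    have hn : n a = 0 := by omega
    simp [hn]
  flip := fun a n δ h0 => by
    obtain ⟨κ, hκ⟩ := h.γ_spinor δ a
    have hne : ∀ i : Fin 2, 1 - i ≠ i := by decide
    by_cases hδ : δ a = 0
    · refine ⟨2 * w a * n a * κ, Function.update n a (n a - 1), Function.update δ a (1 - δ a),
        ?_, fun k => ?_, ?_, fun k hk => Function.update_of_ne hk _ _⟩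
      · rw [h.diracComponent_of_neg hw n (h.chirality_spinor_zero hδ), hκ, hermiteState_smul,
          smul_smul]
      · by_cases hk : k = a
        · subst hk
          simp only [hδ, Fin.val_zero, zero_add] at h0
          simp only [Function.update_self, hδ, sub_zero, Fin.val_one, Fin.val_zero]
          omega
        · simp [hk]
      · rw [Function.update_self]; exact hne _
    · have hδ1 : δ a = 1 := by
        have : ∀ i : Fin 2, i ≠ 0 → i = 1 := by decide
        exact this _ hδ
      refine ⟨-κ, Function.update n a (n a + 1), Function.update δ a (1 - δ a),
        ?_, fun k => ?_, ?_, fun k hk => Function.update_of_ne hk _ _⟩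
      · rw [h.diracComponent_of_pos hw n (h.chirality_spinor_one hδ), hκ, hermiteState_smul,
          neg_smul]
      · by_cases hk : k = a
        · subst hk
          simp only [Function.update_self, hδ1, sub_self, Fin.val_one, Fin.val_zero]
          omega
        · simp [hk]
      · rw [Function.update_self]; exact hne _
  orth := fun n δ n' δ' hne => h.inner_hermiteState hw hne
  ne_zero := fun n δ h0 => hermiteState_ne_zero hw (h.spinor_ne_zero δ) n
    (schwartzIncl_injective (by rw [h0, map_zero]))
  total := closure_span_hermiteState_eq_top hw h.spinor h.span_spinor

end IsCliffordSystem

end Components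

/-! ### Rotation to the singular directions -/

section Rotation

theorem sum_smul_anticommutator (G H : Fin 3 → Matrix (Fin 8) (Fin 8) ℝ) (x y : Fin 3 → ℝ) :
    (∑ j, x j • G j) * (∑ k, y k • H k) + (∑ k, y k • H k) * (∑ j, x j • G j) =
      ∑ j, ∑ k, (x j * y k) • (G j * H k + H k * G j) := by
  rw [Finset.sum_mul_sum, Finset.sum_mul_sum, Finset.sum_comm (γ := Fin 3) (f := fun k j =>
    (y k • H k) * (x j • G j)), ← Finset.sum_add_distrib]
  refine Finset.sum_congr rfl fun j _ => ?_
  rw [← Finset.sum_add_distrib]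
  refine Finset.sum_congr rfl fun k _ => ?_
  rw [smul_mul_smul_comm, smul_mul_smul_comm, mul_comm (y k), smul_add]

/-- The combinations `∑ k, u_a(k) γ_k` of Clifford matrices along an orthonormal basis `u`. -/
noncomputable def rotateMatrices (u : OrthonormalBasis (Fin 3) ℝ E3)
    (γ : Fin 3 → Matrix (Fin 8) (Fin 8) ℝ) (a : Fin 3) : Matrix (Fin 8) (Fin 8) ℝ :=
  ∑ k, u a k • γ k

theorem rotateMatrices_anticomm (u : OrthonormalBasis (Fin 3) ℝ E3)
    {γ : Fin 3 → Matrix (Fin 8) (Fin 8) ℝ}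
    (h : ∀ j k, γ j * γ k + γ k * γ j = if j = k then (-2 : ℝ) • 1 else 0) (a b : Fin 3) :
    rotateMatrices u γ a * rotateMatrices u γ b + rotateMatrices u γ b * rotateMatrices u γ a =
      if a = b then (-2 : ℝ) • 1 else 0 := by
  have e : inner ℝ (u a) (u b) = ∑ k, u a k * u b k := by
    rw [EuclideanSpace.inner_eq_star_dotProduct, dotProduct]
    exact Finset.sum_congr rfl fun k _ => by simp [mul_comm]
  rw [inner_basis] at e
  rw [rotateMatrices, rotateMatrices, sum_smul_anticommutator]
  simp only [h, smul_ite, smul_zero, Finset.sum_ite_eq, Finset.mem_univ, if_true]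
  rw [← Finset.sum_smul, ← e]
  split_ifs <;> simp

theorem rotateMatrices_transpose (u : OrthonormalBasis (Fin 3) ℝ E3)
    {γ : Fin 3 → Matrix (Fin 8) (Fin 8) ℝ} (h : ∀ k, (γ k).transpose = -γ k) (a : Fin 3) :
    (rotateMatrices u γ a).transpose = -rotateMatrices u γ a := by
  simp [rotateMatrices, Matrix.transpose_sum, Matrix.transpose_smul, h]

/-- Clifford systems are preserved by independent rotations of the `γ`'s and the `ρ`'s. -/
theorem IsCliffordSystem.rotate {γ ρ : Fin 3 → Matrix (Fin 8) (Fin 8) ℝ}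
    {γs : Matrix (Fin 8) (Fin 8) ℝ} (h : IsCliffordSystem γ γs ρ)
    (u v : OrthonormalBasis (Fin 3) ℝ E3) :
    IsCliffordSystem (rotateMatrices u γ) γs (rotateMatrices v ρ) where
  γ_antisymm := rotateMatrices_transpose u h.γ_antisymm
  γs_antisymm := h.γs_antisymm
  ρ_antisymm := rotateMatrices_transpose v h.ρ_antisymm
  γ_γ := rotateMatrices_anticomm u h.γ_γ
  γs_γs := h.γs_γs
  γs_γ a := by
    simp only [rotateMatrices, Finset.mul_sum, Finset.sum_mul, ← Finset.sum_add_distrib,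
      mul_smul_comm, smul_mul_assoc, ← smul_add, h.γs_γ, smul_zero, Finset.sum_const_zero]
  ρ_ρ := rotateMatrices_anticomm v h.ρ_ρ
  ρ_γ a b := by
    rw [rotateMatrices, rotateMatrices, sum_smul_anticommutator]
    simp only [h.ρ_γ, smul_zero, Finset.sum_const_zero]
  ρ_γs a := by
    simp only [rotateMatrices, Finset.mul_sum, Finset.sum_mul, ← Finset.sum_add_distrib,
      mul_smul_comm, smul_mul_assoc, ← smul_add, h.ρ_γs, smul_zero, Finset.sum_const_zero]

variable {M : Matrix (Fin 3) (Fin 3) ℝ}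

/-- The images under `M` of the eigenvectors of `Mᵀ M` are orthogonal. -/
theorem inner_mulVec_eigenvectorBasis (M : Matrix (Fin 3) (Fin 3) ℝ) (a b : Fin 3) :
    inner ℝ (WithLp.toLp 2 (M.mulVec
        ((Matrix.isHermitian_conjTranspose_mul_self M).eigenvectorBasis a).ofLp) : E3)
      (WithLp.toLp 2 (M.mulVec
        ((Matrix.isHermitian_conjTranspose_mul_self M).eigenvectorBasis b).ofLp) : E3) =
      if a = b then (Matrix.isHermitian_conjTranspose_mul_self M).eigenvalues b else 0 := by
  set hH := Matrix.isHermitian_conjTranspose_mul_self M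
  have e : inner ℝ (hH.eigenvectorBasis a) (hH.eigenvectorBasis b) = if a = b then (1 : ℝ) else 0 :=
    inner_basis hH.eigenvectorBasis a b
  have h1 := hH.mulVec_eigenvectorBasis b
  rw [← Matrix.mulVec_mulVec] at h1
  rw [EuclideanSpace.inner_eq_star_dotProduct] at e ⊢
  have h2 : (M.mulVec (hH.eigenvectorBasis b).ofLp) ⬝ᵥ star (M.mulVec (hH.eigenvectorBasis a).ofLp)
      = (M.conjTranspose.mulVec (M.mulVec (hH.eigenvectorBasis b).ofLp)) ⬝ᵥ
        star (hH.eigenvectorBasis a).ofLp := by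
    rw [Matrix.star_mulVec, dotProduct_comm, ← Matrix.dotProduct_mulVec, dotProduct_comm]
  rw [h2, h1, smul_dotProduct, e]
  simp

theorem singVal_pos (hM : IsUnit M.det) (a : Fin 3) : 0 < singVal M a := by
  set hH := Matrix.isHermitian_conjTranspose_mul_self M with hHd
  have h1 := inner_mulVec_eigenvectorBasis M a a
  rw [if_pos rfl] at h1
  refine Real.sqrt_pos.2 ?_
  rw [← h1]
  refine real_inner_self_pos.2 fun h0 => ?_
  have h2 : M.mulVec (hH.eigenvectorBasis a).ofLp = 0 := by simpa using h0
  have h3 := Matrix.mulVec_injective_of_isUnit ((Matrix.isUnit_iff_isUnit_det M).2 hM)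
    (h2.trans (Matrix.mulVec_zero M).symm)
  exact hH.eigenvectorBasis.orthonormal.ne_zero a (by ext k; exact congrFun h3 k)

/-- The singular value decomposition of `Mᵀ`: `v` consists of eigenvectors of `Mᵀ M`, and `u_a` is
the normalization of `M v_a`. -/
theorem exists_singular_bases (hM : IsUnit M.det) :
    ∃ u v : OrthonormalBasis (Fin 3) ℝ E3, ∀ (x : E3) (k : Fin 3),
      ∑ j, M j k * x j = ∑ a, singVal M a * inner ℝ (u a) x * v a k := by
  set hH := Matrix.isHermitian_conjTranspose_mul_self M with hHd
  set v := hH.eigenvectorBasis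
  set Mv : Fin 3 → E3 := fun a => WithLp.toLp 2 (M.mulVec (v a).ofLp) with hMv
  have hpos := singVal_pos hM
  have hsq : ∀ a, singVal M a * singVal M a = hH.eigenvalues a := fun a =>
    Real.mul_self_sqrt (Real.sqrt_pos.1 (hpos a)).le
  have ho : Orthonormal ℝ (fun a => (singVal M a)⁻¹ • Mv a) := by
    rw [orthonormal_iff_ite]
    intro a b
    rw [real_inner_smul_left, real_inner_smul_right, inner_mulVec_eigenvectorBasis M a b]
    split_ifs with hab
    · subst hab
      have := (hpos a).ne'
      rw [← hsq]
      field_simp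
    · simp
  refine ⟨OrthonormalBasis.mk ho (ho.linearIndependent.span_eq_top_of_card_eq_finrank
    (by simp)).ge, v, fun x k => ?_⟩
  have h1 : ∀ a, singVal M a * inner ℝ ((singVal M a)⁻¹ • Mv a) x =
      inner ℝ (v a) (WithLp.toLp 2 (M.transpose.mulVec x.ofLp)) := fun a => by
    rw [real_inner_smul_left, mul_inv_cancel_left₀ (hpos a).ne',
      EuclideanSpace.inner_eq_star_dotProduct, EuclideanSpace.inner_eq_star_dotProduct]
    simp only [hMv, star_trivial]
    rw [dotProduct_comm, Matrix.mulVec_transpose, ← Matrix.dotProduct_mulVec, dotProduct_comm,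
      dotProduct_comm]
  have h2 := congrArg (fun y : E3 => y k)
    (v.sum_repr (WithLp.toLp 2 (M.transpose.mulVec x.ofLp)))
  simp only [OrthonormalBasis.repr_apply_apply] at h2
  have h3 : (WithLp.toLp 2 (M.transpose.mulVec x.ofLp) : E3) k = ∑ j, M j k * x j := by
    simp [Matrix.mulVec, dotProduct]
  rw [← h3]
  refine h2.symm.trans ?_
  rw [WithLp.ofLp_sum, Finset.sum_apply]
  refine Finset.sum_congr rfl fun a _ => ?_
  rw [← h1]
  simp

theorem sum_coord_smul_basis (u : OrthonormalBasis (Fin 3) ℝ E3) (k : Fin 3) :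
    ∑ a, u a k • u a = EuclideanSpace.single k (1 : ℝ) := by
  have h := u.sum_repr (EuclideanSpace.single k (1 : ℝ))
  rw [← h]
  refine Finset.sum_congr rfl fun a _ => ?_
  rw [OrthonormalBasis.repr_apply_apply, EuclideanSpace.inner_single_right]
  simp

/-- In the singular directions of `M`, the model operator is the sum of its one-dimensional
components. -/
theorem sum_diracComponent_apply {γ ρ : Fin 3 → Matrix (Fin 8) (Fin 8) ℝ} {R : ℝ}
    {u v : OrthonormalBasis (Fin 3) ℝ E3}
    (huv : ∀ (x : E3) (k : Fin 3),
      ∑ j, M j k * x j = ∑ a, singVal M a * inner ℝ (u a) x * v a k)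
    (f : SchwartzSpinor) (x : E3) :
    (∑ a, diracComponent (rotateMatrices u γ) (rotateMatrices v ρ) u
      (fun a => Real.sqrt 2 * R * singVal M a) a) f x = modelExpr γ ρ M R f x := by
  have e1 : ∑ a, matC (rotateMatrices u γ a) (fderiv ℝ f x (u a)) =
      ∑ k, matC (γ k) (partialDeriv k f x) := by
    simp only [rotateMatrices, matC_sum, _root_.sum_apply, matC_smul, _root_.smul_apply]
    rw [Finset.sum_comm]
    refine Finset.sum_congr rfl fun k _ => ?_
    rw [partialDeriv, ← sum_coord_smul_basis u k, map_sum, map_sum]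
    refine Finset.sum_congr rfl fun a _ => ?_
    rw [map_smul, ← Complex.coe_smul, map_smul]
  have e2 : ∑ a, (Complex.I * ((Real.sqrt 2 * R * singVal M a : ℝ) : ℂ)) •
      ((inner ℝ (u a) x : ℝ) : ℂ) • matC (rotateMatrices v ρ a) (f x) =
      ((Real.sqrt 2 : ℂ) * Complex.I * (R : ℂ)) •
        ∑ j, ∑ k, ((M j k * x j : ℝ) : ℂ) • matC (ρ k) (f x) := by
    rw [Finset.sum_comm (γ := Fin 3)]
    simp only [← Finset.sum_smul, ← Complex.ofReal_sum, huv]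
    simp only [rotateMatrices, matC_sum, _root_.sum_apply, matC_smul, _root_.smul_apply,
      Complex.ofReal_sum, Finset.sum_smul, Finset.smul_sum, smul_smul]
    rw [Finset.sum_comm]
    refine Finset.sum_congr rfl fun k _ => Finset.sum_congr rfl fun a _ => ?_
    congr 1
    push_cast
    ring
  rw [LinearMap.sum_apply, modelExpr, ← e1, ← e2, ← Finset.sum_add_distrib, _root_.sum_apply]
  refine Finset.sum_congr rfl fun a _ => ?_
  rw [diracComponent_apply, _root_.add_apply, _root_.smul_apply, matS_apply, dirDeriv_apply,
    coordMul_apply, matS_apply]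

end Rotation

/-! ### The closure of the model operator -/

section Closure

open scoped SchwartzMap

theorem memLp_norm_mul_schwartz (f : SchwartzSpinor) :
    MemLp (fun x : E3 => ‖x‖ * ‖f x‖) 2 (volume : Measure E3) := by
  have h : MemLp (fun x : E3 => ∑ a, ‖coordMul (EuclideanSpace.single a (1 : ℝ)) f x‖) 2
      (volume : Measure E3) :=
    memLp_finsetSum _ fun a _ =>
      ((coordMul (EuclideanSpace.single a (1 : ℝ)) f).memLp 2 (volume : Measure E3)).norm
  refine h.mono (by have := f.continuous; fun_prop) (Eventually.of_forall fun x => ?_)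
  rw [Real.norm_of_nonneg (by positivity), Real.norm_of_nonneg (by positivity)]
  have h1 : ‖x‖ ≤ ∑ a, |x a| := by
    have e : ∑ a, x a • EuclideanSpace.single a (1 : ℝ) = x := by
      ext k; simp [Pi.single_apply]
    calc ‖x‖ = ‖∑ a, x a • EuclideanSpace.single a (1 : ℝ)‖ := by rw [e]
      _ ≤ ∑ a, ‖x a • EuclideanSpace.single a (1 : ℝ)‖ := norm_sum_le _ _
      _ = ∑ a, |x a| := by simp [norm_smul]
  calc ‖x‖ * ‖f x‖ ≤ (∑ a, |x a|) * ‖f x‖ := by gcongr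
    _ = ∑ a, ‖coordMul (EuclideanSpace.single a (1 : ℝ)) f x‖ := by
      rw [Finset.sum_mul]
      refine Finset.sum_congr rfl fun a _ => ?_
      rw [coordMul_apply, norm_smul, EuclideanSpace.inner_single_left]
      simp

/-- A pointwise error bounded by `1 / (n + 1)` times an `L²` function gives `L²` convergence. -/
theorem tendsto_toLp_of_norm_sub_le {φ : ℕ → E3 → C8} {F : E3 → C8} {G : E3 → ℝ}
    (hφ : ∀ n, MemLp (φ n) 2 (volume : Measure E3)) (hF : MemLp F 2 (volume : Measure E3))
    (hG : MemLp G 2 (volume : Measure E3))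
    (h : ∀ (n : ℕ) x, ‖φ n x - F x‖ ≤ 1 / ((n : ℝ) + 1) * G x) :
    Tendsto (fun n => (hφ n).toLp (φ n)) atTop (𝓝 (hF.toLp F)) := by
  rw [tendsto_iff_norm_sub_tendsto_zero]
  have hlim : Tendsto (fun n : ℕ => 1 / ((n : ℝ) + 1) * ‖hG.toLp G‖) atTop (𝓝 0) := by
    simpa using tendsto_one_div_add_atTop_nhds_zero_nat.mul_const ‖hG.toLp G‖
  refine squeeze_zero (fun _ => norm_nonneg _) (fun n => ?_) hlim
  rw [← MemLp.toLp_sub]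
  refine Lp.norm_le_mul_norm_of_ae_le_mul ?_
  filter_upwards [((hφ n).sub hF).coeFn_toLp, hG.coeFn_toLp] with x h1 h2
  rw [h1, h2]
  exact (h n x).trans (mul_le_mul_of_nonneg_left (le_abs_self _) (by positivity))

/-- Cut-off functions exhausting `ℝ³`, with gradients tending uniformly to zero. -/
theorem exists_cutoff : ∃ (χ : ℕ → E3 → ℝ) (C : ℝ), 0 ≤ C ∧ ∀ n,
    ContDiff ℝ ∞ (χ n) ∧ HasCompactSupport (χ n) ∧
    (∀ x, |χ n x - 1| ≤ 1 / ((n : ℝ) + 1) * ‖x‖) ∧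
    ∀ x, ‖fderiv ℝ (χ n) x‖ ≤ 1 / ((n : ℝ) + 1) * C := by
  set χ : ContDiffBump (0 : E3) := ⟨1, 2, one_pos, one_lt_two⟩
  have hχ : ContDiff ℝ ∞ χ := χ.contDiff
  obtain ⟨C, hC⟩ := (χ.hasCompactSupport.fderiv ℝ).exists_bound_of_continuous
    (hχ.continuous_fderiv (by simp))
  have hc : ∀ n : ℕ, 0 < 1 / ((n : ℝ) + 1) := fun n => by positivity
  refine ⟨fun n x => χ ((1 / ((n : ℝ) + 1)) • x), C, (norm_nonneg _).trans (hC 0), fun n =>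
    ⟨hχ.comp (contDiff_const_smul _), χ.hasCompactSupport.comp_smul (hc n).ne', fun x => ?_,
      fun x => ?_⟩⟩
  · have hn : ‖(1 / ((n : ℝ) + 1)) • x‖ = 1 / ((n : ℝ) + 1) * ‖x‖ := by
      rw [norm_smul, Real.norm_of_nonneg (hc n).le]
    rw [← hn]
    rcases le_total ‖(1 / ((n : ℝ) + 1)) • x‖ 1 with h1 | h1
    · have h2 : χ ((1 / ((n : ℝ) + 1)) • x) = 1 :=
        χ.one_of_mem_closedBall (mem_closedBall_zero_iff.2 h1)
      simp only [h2, sub_self, abs_zero]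
      positivity
    · refine le_trans ?_ h1
      rw [abs_le]
      have := χ.nonneg (x := (1 / ((n : ℝ) + 1)) • x)
      have := χ.le_one (x := (1 / ((n : ℝ) + 1)) • x)
      constructor <;> linarith
  · have hd : HasFDerivAt (fun x => χ ((1 / ((n : ℝ) + 1)) • x))
        ((fderiv ℝ χ ((1 / ((n : ℝ) + 1)) • x)) ∘L
          ((1 / ((n : ℝ) + 1)) • ContinuousLinearMap.id ℝ E3)) x :=
      (hχ.differentiable (by simp) _).hasFDerivAt.comp x
        ((ContinuousLinearMap.id ℝ E3).hasFDerivAt.const_smul (1 / ((n : ℝ) + 1)))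
    rw [hd.fderiv, ContinuousLinearMap.comp_smul, ContinuousLinearMap.comp_id, norm_smul,
      Real.norm_of_nonneg (hc n).le]
    exact mul_le_mul_of_nonneg_left (hC _) (hc n).le

variable {γ ρ : Fin 3 → Matrix (Fin 8) (Fin 8) ℝ} {M : Matrix (Fin 3) (Fin 3) ℝ} {R : ℝ}

theorem testModel_mem_graph (φ : testMaps) :
    (testIncl φ, testModel γ ρ M R φ) ∈ (modelOpMin γ ρ M R).graph := by
  rw [LinearPMap.mem_graph_iff]
  refine ⟨⟨testIncl φ, φ, rfl⟩, rfl, ?_⟩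
  exact congrArg (testModel γ ρ M R)
    ((LinearEquiv.ofInjective testIncl testIncl_injective).symm_apply_apply φ)

theorem mem_graph_modelOpMin {p : HilbL × HilbL} (hp : p ∈ (modelOpMin γ ρ M R).graph) :
    ∃ φ : testMaps, p = (testIncl φ, testModel γ ρ M R φ) := by
  rw [LinearPMap.mem_graph_iff] at hp
  obtain ⟨⟨_, φ, rfl⟩, h1, h2⟩ := hp
  refine ⟨φ, Prod.ext h1.symm (h2.symm.trans ?_)⟩
  exact congrArg (testModel γ ρ M R)
    ((LinearEquiv.ofInjective testIncl testIncl_injective).symm_apply_apply φ)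

theorem modelExpr_smul {χ : E3 → ℝ} (f : SchwartzSpinor) {x : E3} (hχ : DifferentiableAt ℝ χ x) :
    modelExpr γ ρ M R (fun x => χ x • f x) x = χ x • modelExpr γ ρ M R f x +
      ∑ k, fderiv ℝ χ x (EuclideanSpace.single k 1) • matC (γ k) (f x) := by
  have h := hχ.hasFDerivAt.smul f.differentiableAt.hasFDerivAt
  have hp : ∀ k, partialDeriv k (fun x => χ x • f x) x =
      χ x • partialDeriv k f x + fderiv ℝ χ x (EuclideanSpace.single k 1) • f x := fun k => by
    rw [partialDeriv, show (fun x => χ x • f x) = χ • (f : E3 → C8) from rfl, h.fderiv]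
    rfl
  have hm : ∀ (A : Matrix (Fin 8) (Fin 8) ℝ) (r : ℝ) (y : C8), matC A (r • y) = r • matC A y :=
    fun A r y => (matC A).map_smul_of_tower r y
  unfold modelExpr
  simp only [hp, hm, map_add, Finset.sum_add_distrib, smul_add, Finset.smul_sum]
  rw [add_right_comm]
  congr 2
  refine Finset.sum_congr rfl fun j _ => Finset.sum_congr rfl fun k _ => ?_
  rw [smul_comm (χ x), smul_comm (χ x)]

/-- The graph in `L² × L²` of an operator on Schwartz spinors. -/
noncomputable def schwartzGraph (D : SchwartzSpinor →ₗ[ℂ] SchwartzSpinor) :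
    Submodule ℂ (HilbL × HilbL) :=
  LinearMap.range (schwartzIncl.prod (schwartzIncl ∘ₗ D))

/-- Test maps and Schwartz spinors give the same closed graph: a Schwartz spinor, multiplied by
cut-off functions, is approximated by test maps together with its image. -/
theorem closure_graph_modelOpMin {D : SchwartzSpinor →ₗ[ℂ] SchwartzSpinor}
    (hD : ∀ f x, D f x = modelExpr γ ρ M R f x) :
    (modelOpMin γ ρ M R).graph.topologicalClosure = (schwartzGraph D).topologicalClosure := by
  refine le_antisymm (Submodule.topologicalClosure_mono fun p hp => ?_)
    (Submodule.topologicalClosure_minimal _ ?_ (Submodule.isClosed_topologicalClosure _))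
  · obtain ⟨φ, rfl⟩ := mem_graph_modelOpMin hp
    refine ⟨φ.2.2.toSchwartzMap φ.2.1, Prod.ext rfl ?_⟩
    exact MemLp.toLp_congr ((D (φ.2.2.toSchwartzMap φ.2.1)).memLp 2 (volume : Measure E3))
      (modelExpr_memLp γ ρ M R φ) (Eventually.of_forall fun x => hD _ x)
  · rintro _ ⟨f, rfl⟩
    obtain ⟨χ, C, hC0, hχ⟩ := exists_cutoff
    set φ : ℕ → testMaps := fun n => ⟨fun x => χ n x • f x,
      (hχ n).1.smul (f.smooth ⊤), (hχ n).2.1.smul_right⟩ with hφ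
    have hf := f.memLp 2 (volume : Measure E3)
    have hDf := (D f).memLp 2 (volume : Measure E3)
    set K : ℝ := ∑ k, C * ‖matC (γ k)‖
    have t1 : Tendsto (fun n => testIncl (φ n)) atTop (𝓝 (schwartzIncl f)) := by
      refine tendsto_toLp_of_norm_sub_le (F := f) (fun n => testMaps_memLp (φ n)) hf
        (memLp_norm_mul_schwartz f) fun n x => ?_
      calc ‖χ n x • f x - f x‖ = |χ n x - 1| * ‖f x‖ := by
            rw [← Real.norm_eq_abs, ← norm_smul, sub_smul, one_smul]
        _ ≤ 1 / ((n : ℝ) + 1) * ‖x‖ * ‖f x‖ := by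
            gcongr; exact (hχ n).2.2.1 x
        _ = _ := by ring
    have t2 : Tendsto (fun n => testModel γ ρ M R (φ n)) atTop (𝓝 (schwartzIncl (D f))) := by
      refine tendsto_toLp_of_norm_sub_le (F := D f) (fun n => modelExpr_memLp γ ρ M R (φ n)) hDf
        ((memLp_norm_mul_schwartz (D f)).add (hf.norm.const_mul K)) fun n x => ?_
      have e : modelExpr γ ρ M R (φ n) x - D f x = (χ n x - 1) • D f x +
          ∑ k, fderiv ℝ (χ n) x (EuclideanSpace.single k 1) • matC (γ k) (f x) := by
        rw [hφ, modelExpr_smul f ((hχ n).1.differentiable (by simp) x), hD, sub_smul, one_smul]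
        abel
      rw [e]
      refine (norm_add_le _ _).trans ?_
      rw [Pi.add_apply, mul_add]
      refine add_le_add ?_ ?_
      · rw [norm_smul, Real.norm_eq_abs, ← mul_assoc]
        gcongr
        exact (hχ n).2.2.1 x
      · refine (norm_sum_le _ _).trans ?_
        rw [Finset.sum_mul, Finset.mul_sum]
        refine Finset.sum_le_sum fun k _ => ?_
        rw [norm_smul]
        calc ‖fderiv ℝ (χ n) x (EuclideanSpace.single k 1)‖ * ‖matC (γ k) (f x)‖
            ≤ (1 / ((n : ℝ) + 1) * C) * (‖matC (γ k)‖ * ‖f x‖) := by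
              gcongr
              · refine ((fderiv ℝ (χ n) x).le_opNorm _).trans ?_
                simpa using (hχ n).2.2.2 x
              · exact (matC (γ k)).le_opNorm _
          _ = _ := by ring
    exact mem_closure_of_tendsto (t1.prodMk_nhds t2)
      (Eventually.of_forall fun n => testModel_mem_graph (φ n))

/-- A Hilbert basis of Schwartz eigenvectors of a symmetric extension diagonalizes the closure of
the model operator. -/
theorem isDiagonalIn_modelOp {ι : Type*} {D : SchwartzSpinor →ₗ[ℂ] SchwartzSpinor}
    (hD : ∀ f x, D f x = modelExpr γ ρ M R f x) (hsymm : SymmetricVia schwartzIncl D)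
    (b : HilbertBasis ι ℂ HilbL) (μ : ι → ℝ) (x : ι → SchwartzSpinor)
    (hb : ∀ j, b j = schwartzIncl (x j)) (hx : ∀ j, D (x j) = (μ j : ℂ) • x j) :
    IsDiagonalIn (modelOp γ ρ M R) b μ ∧
      (modelOp γ ρ M R).graph = (schwartzGraph D).topologicalClosure := by
  set G := (schwartzGraph D).topologicalClosure with hGdef
  have hG : IsClosed (G : Set (HilbL × HilbL)) := Submodule.isClosed_topologicalClosure _
  have hcoef : ∀ p ∈ G, ∀ i, inner ℂ (b i) p.2 = (μ i : ℂ) * inner ℂ (b i) p.1 := by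
    intro p hp i
    have hcl : IsClosed {p : HilbL × HilbL | inner ℂ (b i) p.2 = (μ i : ℂ) * inner ℂ (b i) p.1} :=
      isClosed_eq (by fun_prop) (by fun_prop)
    refine closure_minimal (s := (schwartzGraph D : Set (HilbL × HilbL))) ?_ hcl hp
    rintro _ ⟨f, rfl⟩
    have h := hsymm (x i) f
    rw [hx, map_smul, inner_smul_left, Complex.conj_ofReal] at h
    simpa [hb] using h.symm
  have hmem := mem_iff_of_eigenbasis hG (b := b) (μ := μ)
    (fun i => Submodule.le_topologicalClosure _ ⟨x i, Prod.ext (hb i).symm (by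
      change schwartzIncl (D (x i)) = (μ i : ℂ) • b i
      rw [hx, map_smul, hb])⟩) hcoef
  have hcl : (modelOpMin γ ρ M R).IsClosable := by
    refine ⟨G.toLinearPMap, ?_⟩
    rw [Submodule.toLinearPMap_graph_eq, closure_graph_modelOpMin hD]
    intro p hp h0
    refine b.ext_inner fun i => ?_
    rw [hcoef p hp i, h0, inner_zero_right, mul_zero]
  have hgraph : (modelOp γ ρ M R).graph = G := by
    rw [modelOp, ← hcl.graph_closure_eq_closure_graph, closure_graph_modelOpMin hD]
  exact ⟨fun y z => by rw [hgraph]; exact hmem y z, hgraph⟩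

end Closure

/-! ### The spectrum of the model operator -/

section Spectrum

variable {γ ρ : Fin 3 → Matrix (Fin 8) (Fin 8) ℝ} {γs : Matrix (Fin 8) (Fin 8) ℝ}

theorem matL_schwartzIncl (B : Matrix (Fin 8) (Fin 8) ℝ) (f : SchwartzSpinor) :
    matL B (schwartzIncl f) = schwartzIncl (matS B f) := by
  refine Lp.ext ?_
  filter_upwards [(matC B).coeFn_compLpL (μ := (volume : Measure E3)) (p := 2) (schwartzIncl f),
    SchwartzMap.coeFn_toLp f 2 (volume : Measure E3),
    SchwartzMap.coeFn_toLp (matS B f) 2 (volume : Measure E3)] with x h1 h2 h3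
  rw [matL, h1]
  exact (congrArg (matC B) h2).trans h3.symm

theorem matL_matL (h : IsCliffordSystem γ γs ρ) (φ : HilbL) : matL γs (matL γs φ) = -φ := by
  refine Lp.ext ?_
  filter_upwards [(matC γs).coeFn_compLpL (μ := (volume : Measure E3)) (p := 2) (matL γs φ),
    (matC γs).coeFn_compLpL (μ := (volume : Measure E3)) (p := 2) φ, Lp.coeFn_neg φ]
    with x h1 h2 h3
  rw [h3]
  refine h1.trans ((congrArg (matC γs) h2).trans ?_)
  rw [← matC_mul, h.γs_γs, matC_neg, matC_one]
  rfl

/-- The matrix `γ_s` anticommutes with each component of the Dirac operator. -/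
theorem IsCliffordSystem.diracComponent_matS (h : IsCliffordSystem γ γs ρ)
    (u : OrthonormalBasis (Fin 3) ℝ E3) (w : Fin 3 → ℝ) (a : Fin 3) (f : SchwartzSpinor) :
    diracComponent γ ρ u w a (matS γs f) = -matS γs (diracComponent γ ρ u w a f) := by
  have h1 := matS_anticomm (h.γs_γ a)
  have h2 := matS_anticomm (h.ρ_γs a)
  simp only [diracComponent_apply, map_add, map_smul, matS_dirDeriv, matS_coordMul, h1, h2,
    map_neg, smul_neg, neg_add, neg_neg]

theorem mem_closure_schwartzGraph_matL {D : SchwartzSpinor →ₗ[ℂ] SchwartzSpinor}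
    {B : Matrix (Fin 8) (Fin 8) ℝ} (hD : ∀ f, D (matS B f) = -matS B (D f)) {x y : HilbL}
    (h : (x, y) ∈ (schwartzGraph D).topologicalClosure) :
    (matL B x, -matL B y) ∈ (schwartzGraph D).topologicalClosure := by
  have hc : Continuous (fun p : HilbL × HilbL => (matL B p.1, -matL B p.2)) := by fun_prop
  refine map_mem_closure (f := fun p : HilbL × HilbL => (matL B p.1, -matL B p.2))
    (s := (schwartzGraph D : Set (HilbL × HilbL))) hc h ?_
  rintro _ ⟨f, rfl⟩
  refine ⟨matS B f, Prod.ext (matL_schwartzIncl B f).symm ?_⟩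
  change schwartzIncl (D (matS B f)) = -matL B (schwartzIncl (D f))
  rw [hD, map_neg, matL_schwartzIncl]

end Spectrum

theorem lemma4p2 (γ : Fin 3 → Matrix (Fin 8) (Fin 8) ℝ) (γs : Matrix (Fin 8) (Fin 8) ℝ)
    (ρ : Fin 3 → Matrix (Fin 8) (Fin 8) ℝ) (hC : IsCliffordSystem γ γs ρ)
    (M : Matrix (Fin 3) (Fin 3) ℝ) (hM : IsUnit M.det) (R : ℝ) (hR : 0 < R) :
    IsSelfAdjoint (modelOp γ ρ M R) ∧
    modelOpMin γ ρ M R ≤ modelOp γ ρ M R ∧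
    HasDiscreteSpectrum (modelOp γ ρ M R) ∧
    Module.finrank ℂ (pmapEigenspace (modelOp γ ρ M R) 0) = 1 ∧
    (∀ z : ℂ, z ≠ 0 → (pmapEigenspace (modelOp γ ρ M R) z ≠ ⊥ ↔
      ∃ d : DataSet, z = (d.energy M R : ℂ))) ∧
    (∃ v : DataSet → HilbL,
      (∀ d, v d ∈ pmapEigenspace (modelOp γ ρ M R) (d.energy M R : ℂ)) ∧
      (∀ d d', v d = v d' ↔ d.Equiv d') ∧
      Orthonormal ℂ ((↑) : Set.range v → HilbL) ∧
      (Submodule.span ℂ (Set.range v)).topologicalClosure =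
        (pmapEigenspace (modelOp γ ρ M R) 0)ᗮ) ∧
    (∀ (z : ℂ) (φ : HilbL), φ ≠ 0 → φ ∈ pmapEigenspace (modelOp γ ρ M R) z →
      matL γs φ ≠ 0 ∧ matL γs φ ∈ pmapEigenspace (modelOp γ ρ M R) (-z)) := by
  obtain ⟨u, v, huv⟩ := exists_singular_bases hM
  set w : Fin 3 → ℝ := fun a => Real.sqrt 2 * R * singVal M a with hwdef
  have hw : ∀ a, 0 < w a := fun a => mul_pos (by positivity) (singVal_pos hM a)
  have hC' := hC.rotate u v
  have hlad := hC'.isLadder (u := u) hw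
  obtain ⟨x, b, hb, hx⟩ := hlad.exists_eigenbasis
  set D := ∑ a, diracComponent (rotateMatrices u γ) (rotateMatrices v ρ) u w a
  have hD : ∀ f x, D f x = modelExpr γ ρ M R f x := sum_diracComponent_apply huv
  obtain ⟨hdiag, hgraph⟩ := isDiagonalIn_modelOp hD
    (SymmetricVia.sum fun a => hC'.diracComponent_symm a) b (labelEnergy w) x hb hx
  have hne : ∀ j, labelEnergy w j ≠ 0 ↔ j ≠ none := by
    rintro (_ | d)
    · simp [labelEnergy]
    · simpa using hlad.labelEnergy_some_ne_zero d
  -- A label stands for the basis vector of its canonical representative.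
  set lab : DataSet → Option CanonLabel := fun d => some ⟨d.canon, d.canon_δ_first⟩ with hlab
  have henergy : ∀ d : DataSet, d.energy M R = labelEnergy w (lab d) := fun d => by
    have e : levelEnergySq w d.canon.level =
        2 * Real.sqrt 2 * R * ∑ k, (d.level k : ℝ) * singVal M k := by
      rw [levelEnergySq, Finset.mul_sum]
      refine Finset.sum_congr rfl fun k _ => ?_
      rw [d.canon_level, hwdef]
      ring
    change _ = ((d.sign : ℤ) : ℝ) * Real.sqrt (levelEnergySq w d.canon.level)
    rw [e, DataSet.energy]
  have hlab_surj : ∀ d : CanonLabel, lab d.1 = some d := fun d =>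
    congrArg some (Subtype.ext (DataSet.canon_eq_self d.2))
  have hrange : Set.range (fun d => b (lab d)) = b '' {j | labelEnergy w j ≠ 0} := by
    simp only [hne]
    ext y
    constructor
    · rintro ⟨d, rfl⟩
      exact ⟨lab d, Option.some_ne_none _, rfl⟩
    · rintro ⟨_ | d, hd, rfl⟩
      · exact absurd rfl hd
      · exact ⟨d.1, congrArg b (hlab_surj d)⟩
  refine ⟨hdiag.isSelfAdjoint, LinearPMap.le_closure _,
    hdiag.hasDiscreteSpectrum (finite_labelEnergy_le hw), ?_, fun z hz => ?_,
    ⟨fun d => b (lab d), fun d => ?_, fun d d' => ?_, ?_, ?_⟩, fun z φ hφ hz => ?_⟩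
  · have hset : {j | (labelEnergy w j : ℂ) = 0} = {none} := by
      ext j
      have := hne j
      simp only [Set.mem_ofPred_eq, Set.mem_singleton_iff, Complex.ofReal_eq_zero]
      tauto
    rw [hdiag.eigenspace_eq_span 0 (by rw [hset]; exact Set.finite_singleton _), hset,
      Set.image_singleton]
    exact finrank_span_singleton (b.orthonormal.ne_zero none)
  · rw [hdiag.eigenspace_ne_bot_iff]
    constructor
    · rintro ⟨_ | d, rfl⟩
      · exact absurd (by simp [labelEnergy]) hz
      · exact ⟨d.1, by rw [henergy, hlab_surj]⟩
    · rintro ⟨d, rfl⟩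
      exact ⟨lab d, by rw [henergy]⟩
  · rw [henergy]
    exact hdiag.basis_mem_eigenspace _
  · rw [DataSet.equiv_iff_canon_eq, b.orthonormal.linearIndependent.injective.eq_iff]
    simp [hlab]
  · rw [hrange]
    exact b.orthonormal.toSubtypeRange.comp (Set.inclusion (Set.image_subset_range _ _))
      (Set.inclusion_injective _)
  · rw [hrange]
    exact hdiag.closure_span_eq
  · have hDγs : ∀ f, D (matS γs f) = -matS γs (D f) := fun f => by
      simp only [D, LinearMap.sum_apply, hC'.diracComponent_matS, map_sum, Finset.sum_neg_distrib]
    refine ⟨fun h0 => hφ ?_, ?_⟩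
    · rw [← neg_eq_zero, ← matL_matL hC, h0, map_zero]
    · rw [mem_pmapEigenspace_iff, hgraph] at hz ⊢
      simpa only [map_smul, neg_smul] using mem_closure_schwartzGraph_matL hDγs hz
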